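/- Let $G_k$ be the free product of $k+1$ cyclic groups of order two with generators $a_1,\dots,a_{k+1}$; it is the vertex set of the Cayley tree of order $k$, where $x,y$ are nearest neighbours iff $y=xa_i$ for some $i$. The root is $x^0=1$, $|x|=d(x,x^0)$ is the length of $x$, $V_n=\{x:|x|\le n\}$, $W_n=\{x:|x|=n\}$, and $G_k^{(2)}=\{x\in G_k:|x|\text{ even}\}$. A configuration $\sigma$ with values in $\{0,1\}$, on the whole tree or on $V_n$, is admissible if $\sigma(x)\sigma(y)=0$ for all nearest neighbours $x,y$ in its domain; $\Omega$ (with the $\sigma$-algebra generated by the cylinder sets) and $\Omega_{V_n}$ are the sets of admissible configurations, and $\#\sigma_n$ is the number of $x\in V_n$ with $\sigma_n(x)=1$. Let $\lambda>0$. The set $\mathbf G$ of Gibbs measures of the two-state hard-core model with activity $\lambda$ consists of the probability measures $\mu$ on $\Omega$ such that for all $n\ge 0$ and $\sigma_n\in\Omega_{V_n}$ $$\mu(\sigma|_{V_n}=\sigma_n)=\int_\Omega \frac{\lambda^{\#\sigma_n}\,\mathbf 1(\sigma_n\vee\omega|_{W_{n+1}}\in\Omega_{V_{n+1}})}{\sum_{\tilde\sigma_n\in\Omega_{V_n}}\lambda^{\#\tilde\sigma_n}\,\mathbf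 1(\tilde\sigma_n\vee\omega|_{W_{n+1}}\in\Omega_{V_{n+1}})}\,\mu(d\omega),$$ where $\sigma_n\vee\omega|_{W_{n+1}}$ denotes the configuration on $V_{n+1}$ equal to $\sigma_n$ on $V_n$ and to $\omega$ on $W_{n+1}$. A Gibbs measure is extreme if it is an extreme point of the convex set $\mathbf G$. A probability measure $\mu$ on $\Omega$ is the hard-core Gibbs measure corresponding to a collection $z=\{z_x>0,\ x\in G_k\}$ if for all $n\ge1$ and $\sigma_n\in\Omega_{V_n}$ $$\mu(\sigma|_{V_n}=\sigma_n)=\frac1{Z_n}\,\lambda^{\#\sigma_n}\prod_{x\in W_n:\ \sigma_n(x)=1}z_x ,$$ where $Z_n$ is the normalizing constant. For a subgroup $H\le G_k$, the measure is $H$-periodic if it corresponds to some $z$ with $z_{yx}=z_x$ for all $x\in G_k$, $y\in H$, and translation-invariant if it is $G_k$-periodic. **Theorem.** Let $k=2$ and $\lambda>4$. Then there are exactly two $G_2^{(2)}$-periodic hard-core Gibbs measures $\mu_1\ne\mu_2$ that are not translation-invariant. They correspond, respectively, to the collections equal to $z_1$ on $G_2^{(2)}$ and $z_2$ on $G_2\setminus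 G_2^{(2)}$, and to $z_2$ on $G_2^{(2)}$ and $z_1$ on $G_2\setminus G_2^{(2)}$, where $$z_1=\left(\frac{\lambda+\sqrt{\lambda^2-4\lambda}}{2\lambda}\right)^2,\qquad z_2=\left(\frac{\lambda-\sqrt{\lambda^2-4\lambda}}{2\lambda}\right)^2 .$$ Both $\mu_1$ and $\mu_2$ are extreme, i.e. they are extreme points of the set $\mathbf G$ of all hard-core Gibbs measures with activity $\lambda$. -/

import Mathlib

open scoped NNReal

namespace HardCore

/-! ## The Cayley tree -/

/-- The group `G_k`: the free product of `k + 1` cyclic groups of order two. -/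
abbrev G (k : ℕ) : Type := Monoid.CoprodI (fun _ : Fin (k + 1) => Multiplicative (ZMod 2))

/-- The generators `a_1, …, a_{k+1}` of `G_k`. -/
def gen (k : ℕ) (i : Fin (k + 1)) : G k :=
  Monoid.CoprodI.of (M := fun _ : Fin (k + 1) => Multiplicative (ZMod 2)) (i := i)
    (Multiplicative.ofAdd 1)

/-- The Cayley tree of order `k` on the vertex set `G_k`: `x` and `y` are nearest neighbours when
`y = x a_i` for some generator `a_i`. -/
def tree (k : ℕ) : SimpleGraph (G k) := SimpleGraph.mulCayley (Set.range (gen k))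

/-- The length `|x|` of `x`, i.e. its distance in the tree to the root `x⁰ = 1`. -/
noncomputable def len {k : ℕ} (x : G k) : ℕ := (tree k).dist 1 x

lemma gen_mul_self (k : ℕ) (i : Fin (k + 1)) : gen k i * gen k i = 1 := by
  unfold gen
  rw [← map_mul]
  have h : (Multiplicative.ofAdd (1 : ZMod 2)) * Multiplicative.ofAdd 1 = 1 := by decide
  rw [h, map_one]

/-- The homomorphism `G_k → ℤ/2` that sends every generator to `1`. -/
def parity (k : ℕ) : G k →* Multiplicative (ZMod 2) :=
  Monoid.CoprodI.lift (fun _ => MonoidHom.id _)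

lemma parity_gen (k : ℕ) (i : Fin (k + 1)) : parity k (gen k i) = Multiplicative.ofAdd 1 := by
  simp [parity, gen]

lemma tree_adj {k : ℕ} {x y : G k} : (tree k).Adj x y ↔ ∃ i, y = x * gen k i := by
  unfold tree
  rw [SimpleGraph.mulCayley_adj']
  constructor
  · rintro ⟨-, g, ⟨i, rfl⟩, h | h⟩
    · exact ⟨i, h.symm⟩
    · exact ⟨i, by rw [h, mul_assoc, gen_mul_self, mul_one]⟩
  · rintro ⟨i, rfl⟩
    refine ⟨fun h => ?_, gen k i, ⟨i, rfl⟩, Or.inl rfl⟩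
    have h1 : gen k i = 1 := by simpa using h.symm
    have h2 := parity_gen k i
    rw [h1, map_one] at h2
    exact absurd h2 (by decide)

lemma tree_connected (k : ℕ) : (tree k).Connected := by
  have key : ∀ x y : G k, (tree k).Reachable y (y * x) := by
    intro x
    induction x using Monoid.CoprodI.induction_on with
    | one => intro y; rw [mul_one]
    | of i m =>
      intro y
      have hm : m = 1 ∨ m = Multiplicative.ofAdd 1 := by revert m; decide
      rcases hm with rfl | rfl
      · rw [map_one, mul_one]
      · exact SimpleGraph.Adj.reachable (tree_adj.2 ⟨i, rfl⟩)
    | mul a b ha hb =>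
      intro y
      rw [← mul_assoc]
      exact (ha y).trans (hb (y * a))
  refine SimpleGraph.Connected.mk (fun x y => ?_)
  have h := key (x⁻¹ * y) x
  rwa [mul_inv_cancel_left] at h

lemma parity_walk {k : ℕ} {x y : G k} (w : (tree k).Walk x y) :
    parity k y = parity k x * Multiplicative.ofAdd (w.length : ZMod 2) := by
  induction w with
  | nil => simp
  | cons h p ih =>
    obtain ⟨i, rfl⟩ := tree_adj.1 h
    rw [ih, map_mul, parity_gen, SimpleGraph.Walk.length_cons, Nat.cast_add, Nat.cast_one]
    generalize parity k _ = a
    generalize ((p.length : ℕ) : ZMod 2) = b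
    rw [add_comm b 1, ofAdd_add, mul_assoc]

lemma even_len_iff {k : ℕ} (x : G k) : Even (len x) ↔ parity k x = 1 := by
  obtain ⟨w, hw⟩ := (tree_connected k).exists_walk_length_eq_dist 1 x
  rw [parity_walk w, map_one, one_mul, hw, ← ofAdd_zero, Multiplicative.ofAdd.injective.eq_iff,
    ZMod.natCast_eq_zero_iff_even]
  rfl

lemma finite_ball (k n : ℕ) : {x : G k | len x ≤ n}.Finite := by
  have key : ∀ (m : ℕ) (x y : G k) (w : (tree k).Walk x y), w.length = m →
      ∃ l : List (Fin (k + 1)), l.length = m ∧ y = x * (l.map (gen k)).prod := by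
    intro m x y w
    induction w generalizing m with
    | nil => rintro rfl; exact ⟨[], rfl, by simp⟩
    | cons h p ih =>
      rintro rfl
      obtain ⟨i, rfl⟩ := tree_adj.1 h
      obtain ⟨l, hl, rfl⟩ := ih _ rfl
      exact ⟨i :: l, by simp [hl], by simp [mul_assoc]⟩
  refine ((List.finite_length_le (Fin (k + 1)) n).image
    (fun l => (l.map (gen k)).prod)).subset ?_
  intro x hx
  obtain ⟨w, hw⟩ := (tree_connected k).exists_walk_length_eq_dist 1 x
  obtain ⟨l, hl, h⟩ := key _ _ _ w rfl
  refine ⟨l, ?_, by simpa using h.symm⟩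
  have : w.length ≤ n := hw ▸ hx
  simpa [hl] using this

/-- The ball `V_n = {x : d(x, x⁰) ≤ n}`. -/
noncomputable def V (k n : ℕ) : Finset (G k) := (finite_ball k n).toFinset

lemma mem_V {k n : ℕ} {x : G k} : x ∈ V k n ↔ len x ≤ n := by simp [V]

/-- The sphere `W_n = {x : d(x, x⁰) = n}`. -/
noncomputable def W (k n : ℕ) : Finset (G k) := (V k n).filter (fun x => len x = n)

lemma mem_W {k n : ℕ} {x : G k} : x ∈ W k n ↔ len x = n := by
  simp only [W, Finset.mem_filter, mem_V, and_iff_right_iff_imp]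
  exact fun h => h.le

lemma W_subset_V (k n : ℕ) : W k n ⊆ V k n := Finset.filter_subset _ _

lemma mem_W_succ_of_not_mem_V {k n : ℕ} {x : G k} (hx : x ∈ V k (n + 1)) (h : x ∉ V k n) :
    x ∈ W k (n + 1) := by
  rw [mem_V] at hx h
  rw [mem_W]
  omega

/-- The subgroup `G_k^{(2)}` of all elements of even length. -/
def evenSubgroup (k : ℕ) : Subgroup (G k) where
  carrier := {x | Even (len x)}
  one_mem' := (even_len_iff 1).2 (map_one _)
  mul_mem' := by
    intro a b ha hb
    rw [Set.mem_ofPred_eq, even_len_iff] at *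
    rw [map_mul, ha, hb, one_mul]
  inv_mem' := by
    intro a ha
    rw [Set.mem_ofPred_eq, even_len_iff] at *
    rw [map_inv, ha, inv_one]

/-! ## Admissible configurations -/

/-- A configuration on `A` is admissible if no two neighbouring vertices of `A` are both
occupied (`1` = occupied, `0` = vacant). -/
def Admissible {k : ℕ} (A : Set (G k)) (σ : A → Fin 2) : Prop :=
  ∀ x y : A, (tree k).Adj x y → ¬ (σ x = 1 ∧ σ y = 1)

/-- The space `Ω` of admissible configurations on the whole tree. Its measurable structure is the
one inherited from the product `σ`-algebra, i.e. the one generated by cylinder sets. -/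
abbrev Ω (k : ℕ) : Type :=
  {σ : G k → Fin 2 // ∀ x y : G k, (tree k).Adj x y → ¬ (σ x = 1 ∧ σ y = 1)}

/-- The set `Ω_{V_n}` of admissible configurations on the ball `V_n`. -/
abbrev ΩV (k n : ℕ) : Type := {σ : V k n → Fin 2 // Admissible (V k n : Set (G k)) σ}

noncomputable instance (k n : ℕ) : Fintype (ΩV k n) := Fintype.ofFinite _

/-- The restriction `σ|_A` of a configuration. -/
def restr {k : ℕ} (A : Finset (G k)) (ω : Ω k) : A → Fin 2 := fun x => ω.1 x

/-- The concatenation `σ_n ∨ ω_{n+1}` of a configuration on `V_n` and one on `W_{n+1}`. -/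
noncomputable def join {k n : ℕ} (σ : V k n → Fin 2) (ω : W k (n + 1) → Fin 2) :
    V k (n + 1) → Fin 2 := by
  classical
  exact fun x => if h : (x : G k) ∈ V k n then σ ⟨x, h⟩
    else ω ⟨x, mem_W_succ_of_not_mem_V x.2 h⟩

/-- The number `#σ_n` of occupied vertices. -/
noncomputable def numOcc {k n : ℕ} (σ : V k n → Fin 2) : ℕ := (Finset.univ.filter (fun x => σ x = 1)).card

/-! ## Gibbs measures -/

open Classical in
/-- The unnormalised weight `λ^{#σ_n} 1(σ_n ∨ ω_{n+1} ∈ Ω_{V_{n+1}})`. -/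
noncomputable def bdryWeight {k n : ℕ} (lam : ℝ) (σ : ΩV k n) (ω : W k (n + 1) → Fin 2) : ℝ :=
  if Admissible (V k (n + 1) : Set (G k)) (join σ.1 ω) then lam ^ numOcc σ.1 else 0

/-- The conditional probability `P_n(σ_n | ω_{n+1})`. -/
noncomputable def condProb {k n : ℕ} (lam : ℝ) (σ : ΩV k n) (ω : W k (n + 1) → Fin 2) : ℝ :=
  bdryWeight lam σ ω / ∑ τ : ΩV k n, bdryWeight lam τ ω

/-- The set of all hard-core Gibbs measures of activity `λ`: the probability measures on `Ω` that
satisfy the DLR equations for all balls `V_n`. -/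
def gibbsMeasures (k : ℕ) (lam : ℝ) : Set (MeasureTheory.Measure (Ω k)) :=
  {μ | MeasureTheory.IsProbabilityMeasure μ ∧ ∀ (n : ℕ) (σ : ΩV k n),
    μ.real {ω | restr (V k n) ω = σ.1} = ∫ ω, condProb lam σ (restr (W k (n + 1)) ω) ∂μ}

/-- The unnormalised weight `λ^{#σ_n} ∏_{x ∈ W_n} z_{σ(x),x}`, with `z_{0,x} = 1`,
`z_{1,x} = z_x`. -/
noncomputable def zWeight {k n : ℕ} (lam : ℝ) (z : G k → ℝ) (σ : ΩV k n) : ℝ :=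
  lam ^ numOcc σ.1 *
    ∏ x : W k n, if σ.1 ⟨x, W_subset_V k n x.2⟩ = 1 then z x else 1

/-- The measure `μ^{(n)}` on `Ω_{V_n}` given by the collection `z`. -/
noncomputable def zProb {k n : ℕ} (lam : ℝ) (z : G k → ℝ) (σ : ΩV k n) : ℝ :=
  zWeight lam z σ / ∑ τ : ΩV k n, zWeight lam z τ

/-- `μ` is the hard-core Gibbs measure corresponding to the collection `z` of positive numbers:
its marginals on the balls `V_n`, `n ≥ 1`, are the measures `μ^{(n)}`. (The value of `z` at the
root plays no role.) -/
def Corresponds {k : ℕ} (lam : ℝ) (z : G k → ℝ) (μ : MeasureTheory.Measure (Ω k)) : Prop :=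
  (∀ x, 0 < z x) ∧ MeasureTheory.IsProbabilityMeasure μ ∧
    ∀ n, 1 ≤ n → ∀ σ : ΩV k n, μ.real {ω | restr (V k n) ω = σ.1} = zProb lam z σ

/-- `z` is periodic with respect to the subgroup `H`. -/
def IsPeriodic {k : ℕ} (H : Subgroup (G k)) (z : G k → ℝ) : Prop :=
  ∀ x : G k, ∀ y ∈ H, z (y * x) = z x

/-- `μ` is an `H`-periodic hard-core Gibbs measure. -/
def IsPeriodicGibbs {k : ℕ} (lam : ℝ) (H : Subgroup (G k))
    (μ : MeasureTheory.Measure (Ω k)) : Prop :=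
  ∃ z : G k → ℝ, IsPeriodic H z ∧ Corresponds lam z μ

/-- `μ` is a translation-invariant, i.e. `G_k`-periodic, hard-core Gibbs measure. -/
def IsTranslationInvariantGibbs {k : ℕ} (lam : ℝ) (μ : MeasureTheory.Measure (Ω k)) : Prop :=
  IsPeriodicGibbs lam (⊤ : Subgroup (G k)) μ

open Classical in
/-- The collection equal to `a` on `G_k^{(2)}` and to `b` off it. -/
noncomputable def alternating (k : ℕ) (a b : ℝ) : G k → ℝ :=
  fun x => if x ∈ evenSubgroup k then a else b

end HardCore

/-! Write F(t) = (1 + λt)⁻². A positive collection `z` has a corresponding measure iff z_x = ∏ (1 +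
λ z_y)⁻¹ over the children y of x, for every x ≠ 1. Necessity compares marginals on consecutive
balls (`Corresponds.recursion`). Sufficiency needs no extension theorem: the measure is the law of a
tree-indexed Markov chain driven by independent proposals (`chainMeasure_eq_zProb`,
`corresponds_chainMeasure`). The root, with its extra child, plays no role.

An even-periodic collection takes a value a on even vertices and b on odd ones, so the recursion
becomes a = F(b), b = F(a); the measure is translation-invariant iff a = b. If a ≠ b, put a = u², b
= v²: subtracting u(1 + λv²) = 1 and v(1 + λu²) = 1 gives λuv = 1, then u + v = 1. Thus u, v are the
two roots of λt(1 - t) = 1, and their two orderings give the two measures (`scalarStep_two_cycle`,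
`eq_roots`).

Extremality is a domination argument. Let p be the chessboard configuration occupied where z = z₁.
Recording a configuration by the set where it agrees with p turns the exclusion rule into an
attractive one, so the FKG inequality applies: if p is occupied on W_n, vacancy on W_{n+1} maximises
the probability of agreeing with p on any finite S (`sum_condProb_le`). By DLR this bounds every
Gibbs measure. Integrating out 2j levels turns the vacant boundary into the constant boundary value
F^{2j}(1), which decreases to z₁ (`tendsto_iterate_scalarStep`), so the bound tends to the value for
the periodic measure itself. That measure therefore maximises all agreement events at once. They
form a generating π-system, so it cannot be a proper mixture of other Gibbs measures
(`mem_extremePoints_of_dominates`). -/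

namespace HardCore

/-! ## Parents and children in the Cayley tree -/

section Tree

variable {k : ℕ}

/-- The reduced word of `x⁻¹`, i.e. the reduced word of `x` read backwards. -/
noncomputable def revWord (x : G k) :
    Monoid.CoprodI.Word (fun _ : Fin (k + 1) => Multiplicative (ZMod 2)) :=
  x⁻¹ • Monoid.CoprodI.Word.empty

/-- The index of the last letter of `x`. -/
noncomputable def lastIdx (x : G k) : Option (Fin (k + 1)) := (revWord x).fstIdx

lemma mul_gen_mul_gen (x : G k) (i : Fin (k + 1)) : x * gen k i * gen k i = x := by
  rw [mul_assoc, gen_mul_self, mul_one]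

/-- The reason for inverting: words carry a left action that exposes the first letter, whereas tree
edges are right multiplications. Generators are involutions, so no inverse survives. -/
lemma revWord_mul_gen (x : G k) (i : Fin (k + 1)) :
    revWord (x * gen k i) = gen k i • revWord x := by
  unfold revWord
  rw [mul_inv_rev, mul_smul, inv_eq_of_mul_eq_one_left (gen_mul_self k i)]

lemma revWord_eq_empty_iff (x : G k) : revWord x = Monoid.CoprodI.Word.empty ↔ x = 1 := by
  constructor
  · intro h
    have h2 := congrArg Monoid.CoprodI.Word.prod h
    rw [revWord, Monoid.CoprodI.Word.prod_smul] at h2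
    simpa using h2
  · rintro rfl
    simp [revWord]

lemma lastIdx_eq_none_iff (x : G k) : lastIdx x = none ↔ x = 1 := by
  rw [← revWord_eq_empty_iff, lastIdx, Monoid.CoprodI.Word.fstIdx, Monoid.CoprodI.Word.ext_iff]
  simp

lemma ofAdd_one_ne_one : (Multiplicative.ofAdd (1 : ZMod 2)) ≠ 1 := by decide

lemma revWord_mul_gen_of_ne {x : G k} {i : Fin (k + 1)} (h : (revWord x).fstIdx ≠ some i) :
    revWord (x * gen k i) =
      Monoid.CoprodI.Word.cons (M := fun _ : Fin (k + 1) => Multiplicative (ZMod 2))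
        (Multiplicative.ofAdd 1) (revWord x) h ofAdd_one_ne_one := by
  rw [revWord_mul_gen, gen, Monoid.CoprodI.Word.of_smul_def,
    Monoid.CoprodI.Word.equivPair_eq_of_fstIdx_ne h]
  simp only [mul_one]
  exact dif_neg ofAdd_one_ne_one

lemma lastIdx_mul_gen {x : G k} {i : Fin (k + 1)} (h : lastIdx x ≠ some i) :
    lastIdx (x * gen k i) = some i := by
  unfold lastIdx at h
  rw [lastIdx, revWord_mul_gen_of_ne h, Monoid.CoprodI.Word.fstIdx_cons]

/-- Each factor has a single nontrivial element, so multiplying by the generator of the last letter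
cancels that letter, and in a reduced word the next letter has another index. -/
lemma lastIdx_mul_gen_ne {x : G k} {i : Fin (k + 1)} (h : lastIdx x = some i) :
    lastIdx (x * gen k i) ≠ some i := by
  have hp := Monoid.CoprodI.Word.equivPair_smul_same (i := i) (Multiplicative.ofAdd (1 : ZMod 2))
    (revWord x)
  set p := Monoid.CoprodI.Word.equivPair i (revWord x) with hpdef
  have hx : revWord x = Monoid.CoprodI.Word.rcons p := by
    rw [← Monoid.CoprodI.Word.equivPair_symm, hpdef, Equiv.symm_apply_apply]
  have hm : p.head = 1 ∨ p.head = Multiplicative.ofAdd 1 := by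
    generalize p.head = m
    revert m; decide
  rcases hm with hm | hm
  · exfalso
    rw [Monoid.CoprodI.Word.rcons, dif_pos hm] at hx
    exact p.fstIdx_ne (hx ▸ h)
  · have h1 : revWord (x * gen k i) = p.tail := by
      rw [revWord_mul_gen, gen, Monoid.CoprodI.Word.of_smul_def, ← hpdef, hm]
      exact dif_pos (show Multiplicative.ofAdd (1 : ZMod 2) * Multiplicative.ofAdd 1 = 1 by decide)
    rw [lastIdx, h1]
    exact p.fstIdx_ne

lemma wordLength_mul_gen {x : G k} {i : Fin (k + 1)} (h : lastIdx x ≠ some i) :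
    (revWord (x * gen k i)).toList.length = (revWord x).toList.length + 1 := by
  unfold lastIdx at h
  rw [revWord_mul_gen_of_ne h]
  simp

lemma wordLength_mul_gen_of_eq {x : G k} {i : Fin (k + 1)} (h : lastIdx x = some i) :
    (revWord (x * gen k i)).toList.length + 1 = (revWord x).toList.length := by
  rw [← wordLength_mul_gen (lastIdx_mul_gen_ne h), mul_gen_mul_gen]

lemma wordLength_le_of_walk {x y : G k} (w : (tree k).Walk x y) :
    (revWord y).toList.length ≤ (revWord x).toList.length + w.length := by
  induction w with
  | nil => simp
  | @cons u v _ h p ih =>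
    obtain ⟨i, rfl⟩ := tree_adj.1 h
    rw [SimpleGraph.Walk.length_cons]
    by_cases hi : lastIdx u = some i
    · have := wordLength_mul_gen_of_eq hi
      omega
    · have := wordLength_mul_gen hi
      omega

lemma exists_lastIdx {x : G k} (hx : x ≠ 1) : ∃ i, lastIdx x = some i :=
  Option.ne_none_iff_exists'.1 (mt (lastIdx_eq_none_iff x).1 hx)

/-- Stripping last letters one by one gives a path to the root; conversely a step of a walk
lengthens the word by at most one. -/
lemma len_eq_wordLength (x : G k) : len x = (revWord x).toList.length := by
  apply le_antisymm
  · suffices H : ∀ n (x : G k), (revWord x).toList.length = n → len x ≤ n from H _ x rfl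
    intro n
    induction n with
    | zero =>
      intro x hx
      have : x = 1 := by
        rw [← revWord_eq_empty_iff, Monoid.CoprodI.Word.ext_iff]
        simpa using hx
      simp [this, len]
    | succ n ih =>
      intro x hx
      have hx1 : x ≠ 1 := by
        rintro rfl
        rw [(revWord_eq_empty_iff (1 : G k)).2 rfl] at hx
        simp at hx
      obtain ⟨i, hi⟩ := exists_lastIdx hx1
      have h1 := ih (x * gen k i) (by have := wordLength_mul_gen_of_eq hi; omega)
      have h2 : (tree k).Adj (x * gen k i) x := tree_adj.2 ⟨i, (mul_gen_mul_gen x i).symm⟩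
      have h3 := (tree_connected k).dist_triangle (u := 1) (v := x * gen k i) (w := x)
      rw [SimpleGraph.dist_eq_one_iff_adj.2 h2] at h3
      exact h3.trans (Nat.add_le_add_right h1 1)
  · obtain ⟨w, hw⟩ := (tree_connected k).exists_walk_length_eq_dist 1 x
    have := wordLength_le_of_walk w
    rw [(revWord_eq_empty_iff (1 : G k)).2 rfl, hw] at this
    simpa [len] using this

lemma len_mul_gen {x : G k} {i : Fin (k + 1)} (h : lastIdx x ≠ some i) :
    len (x * gen k i) = len x + 1 := by
  rw [len_eq_wordLength, len_eq_wordLength, wordLength_mul_gen h]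

lemma len_one : len (1 : G k) = 0 := by simp [len]

lemma len_eq_zero_iff {x : G k} : len x = 0 ↔ x = 1 := by
  rw [len, (tree_connected k).dist_eq_zero_iff, eq_comm]

/-- The parent of a vertex: its neighbour on the path to the root (the root is its own parent). -/
noncomputable def parent (x : G k) : G k :=
  match lastIdx x with
  | none => x
  | some i => x * gen k i

lemma parent_of_lastIdx {x : G k} {i : Fin (k + 1)} (h : lastIdx x = some i) :
    parent x = x * gen k i := by
  simp [parent, h]

lemma parent_mul_gen {x : G k} {i : Fin (k + 1)} (h : lastIdx x ≠ some i) :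
    parent (x * gen k i) = x := by
  rw [parent_of_lastIdx (lastIdx_mul_gen h), mul_gen_mul_gen]

lemma mul_gen_ne_one {x : G k} {i : Fin (k + 1)} (h : lastIdx x ≠ some i) :
    x * gen k i ≠ 1 := by
  rw [ne_eq, ← len_eq_zero_iff, len_mul_gen h]
  omega

lemma len_parent {x : G k} (hx : x ≠ 1) : len (parent x) + 1 = len x := by
  obtain ⟨i, hi⟩ := exists_lastIdx hx
  rw [parent_of_lastIdx hi, ← len_mul_gen (lastIdx_mul_gen_ne hi), mul_gen_mul_gen]

lemma len_parent_lt {x : G k} (hx : x ≠ 1) : len (parent x) < len x := by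
  have := len_parent hx
  omega

lemma adj_parent {x : G k} (hx : x ≠ 1) : (tree k).Adj x (parent x) := by
  obtain ⟨i, hi⟩ := exists_lastIdx hx
  exact tree_adj.2 ⟨i, parent_of_lastIdx hi⟩

lemma adj_iff_parent {x y : G k} :
    (tree k).Adj x y ↔ (x ≠ 1 ∧ parent x = y) ∨ (y ≠ 1 ∧ parent y = x) := by
  constructor
  · intro h
    obtain ⟨i, rfl⟩ := tree_adj.1 h
    by_cases hi : lastIdx x = some i
    · left
      refine ⟨fun h1 => ?_, parent_of_lastIdx hi⟩
      rw [← lastIdx_eq_none_iff, hi] at h1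
      simp at h1
    · exact Or.inr ⟨mul_gen_ne_one hi, parent_mul_gen hi⟩
  · rintro (⟨h, rfl⟩ | ⟨h, rfl⟩)
    · exact adj_parent h
    · exact (adj_parent h).symm

/-- The children (direct successors) of a vertex. -/
noncomputable def children (x : G k) : Finset (G k) := by
  classical
  exact (Finset.univ.filter (fun i => lastIdx x ≠ some i)).image (fun i => x * gen k i)

lemma mem_children {x y : G k} : y ∈ children x ↔ y ≠ 1 ∧ parent y = x := by
  classical
  simp only [children, Finset.mem_image, Finset.mem_filter, Finset.mem_univ, true_and]
  constructor
  · rintro ⟨i, hi, rfl⟩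
    exact ⟨mul_gen_ne_one hi, parent_mul_gen hi⟩
  · rintro ⟨hy, rfl⟩
    obtain ⟨i, hi⟩ := exists_lastIdx hy
    rw [parent_of_lastIdx hi]
    exact ⟨i, lastIdx_mul_gen_ne hi, mul_gen_mul_gen y i⟩

lemma len_of_mem_children {x y : G k} (h : y ∈ children x) : len y = len x + 1 := by
  obtain ⟨hy, rfl⟩ := mem_children.1 h
  exact (len_parent hy).symm

lemma card_children_aux (x : G k) :
    (children x).card = (Finset.univ.filter (fun i => lastIdx x ≠ some i)).card := by
  classical
  unfold children
  rw [Finset.card_image_of_injOn]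
  · intro i hi j hj hij
    simp only [Finset.coe_filter, Finset.mem_univ, true_and, Set.mem_ofPred_eq] at hi hj
    have := lastIdx_mul_gen hi
    rw [show x * gen k i = x * gen k j from hij, lastIdx_mul_gen hj] at this
    simpa using this.symm

/-- All generators except the last letter lead away from the root. At the root none is lost, hence
the restriction `x ≠ 1` throughout. -/
lemma card_children {x : G k} (hx : x ≠ 1) : (children x).card = k := by
  obtain ⟨i, hi⟩ := exists_lastIdx hx
  rw [card_children_aux, hi]
  simp only [ne_eq, Option.some.injEq]
  rw [Finset.filter_not, Finset.card_sdiff]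
  simp [Finset.filter_eq]

lemma card_children_one : (children (1 : G k)).card = k + 1 := by
  rw [card_children_aux, (lastIdx_eq_none_iff 1).2 rfl]
  simp

/-- Every level of the tree of order at least one is nonempty. -/
lemma exists_len_eq (hk : 1 ≤ k) (n : ℕ) : ∃ x : G k, len x = n := by
  induction n with
  | zero => exact ⟨1, len_one⟩
  | succ n ih =>
    obtain ⟨x, rfl⟩ := ih
    have : 0 < (children x).card := by
      by_cases hx : x = 1
      · subst hx; rw [card_children_one]; omega
      · rw [card_children hx]; omega
    obtain ⟨y, hy⟩ := Finset.card_pos.1 this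
    exact ⟨y, len_of_mem_children hy⟩

lemma even_len_iff_of_adj {x y : G k} (h : (tree k).Adj x y) : Even (len x) ↔ ¬ Even (len y) := by
  rcases adj_iff_parent.1 h with ⟨hx, rfl⟩ | ⟨hy, rfl⟩
  · rw [← len_parent hx, Nat.even_add_one]
  · rw [← len_parent hy, Nat.even_add_one, not_not]

end Tree

open MeasureTheory

/-! ## Cylinder events -/

section Cylinder

variable {k : ℕ}

/-- The restriction of an admissible configuration on the tree to the ball `V_n`. -/
noncomputable def resV (n : ℕ) (ω : Ω k) : ΩV k n :=
  ⟨restr (V k n) ω, fun x y h => ω.2 x y h⟩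

/-- Extension by vacancies is admissible. Weights on a ball can thus be computed for a global
configuration, avoiding products over subtypes. -/
lemma resV_surjective (n : ℕ) : Function.Surjective (resV (k := k) n) := by
  classical
  intro σ
  refine ⟨⟨fun x => if h : x ∈ V k n then σ.1 ⟨x, h⟩ else 0, ?_⟩, ?_⟩
  · rintro x y hxy ⟨hx, hy⟩
    dsimp only at hx hy
    split_ifs at hx hy with h1 h2
    · exact σ.2 ⟨x, h1⟩ ⟨y, h2⟩ hxy ⟨hx, hy⟩
    · simp at hy
    · simp at hx
    · simp at hx
  · apply Subtype.ext
    funext x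
    have : (x : G k) ∈ V k n := x.2
    simp [resV, restr]

lemma resV_eq_iff {n : ℕ} {ω t : Ω k} : resV n ω = resV n t ↔ ∀ x ∈ V k n, ω.1 x = t.1 x := by
  rw [Subtype.ext_iff, funext_iff, Subtype.forall]
  rfl

lemma measurable_eval (x : G k) : Measurable (fun ω : Ω k => ω.1 x) :=
  (measurable_pi_apply x).comp measurable_subtype_coe

lemma measurable_restr (A : Finset (G k)) : Measurable (restr (k := k) A) :=
  measurable_pi_lambda _ (fun x => measurable_eval (x : G k))

lemma restr_eq_iff {n : ℕ} {σ : ΩV k n} {ω : Ω k} : restr (V k n) ω = σ.1 ↔ resV n ω = σ := by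
  rw [Subtype.ext_iff]; rfl

lemma measurableSet_cylinder {n : ℕ} (σ : ΩV k n) : MeasurableSet {ω | restr (V k n) ω = σ.1} :=
  measurable_restr _ (measurableSet_singleton _)

/-- An integral of a function of the restriction to `V_n` is a finite sum. -/
lemma integral_resV {μ : Measure (Ω k)} [IsProbabilityMeasure μ] {n : ℕ} (F : ΩV k n → ℝ) :
    ∫ ω, F (resV n ω) ∂μ = ∑ σ, F σ * μ.real {ω | restr (V k n) ω = σ.1} := by
  classical
  have h : ∀ ω : Ω k, F (resV n ω) =
      ∑ σ, Set.indicator {ω : Ω k | restr (V k n) ω = σ.1} (fun _ => F σ) ω := by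
    intro ω
    rw [Finset.sum_eq_single (resV n ω)]
    · rw [Set.indicator_of_mem]
      exact restr_eq_iff.2 rfl
    · intro σ _ hσ
      rw [Set.indicator_of_notMem]
      exact fun h => hσ (restr_eq_iff.1 h).symm
    · simp
  simp_rw [h]
  rw [integral_finsetSum]
  · refine Finset.sum_congr rfl fun σ _ => ?_
    rw [integral_indicator_const _ (measurableSet_cylinder σ), smul_eq_mul, mul_comm]
  · exact fun σ _ => (integrable_const _).indicator (measurableSet_cylinder σ)

lemma sum_real_cylinder (μ : Measure (Ω k)) [IsProbabilityMeasure μ] (n : ℕ) :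
    ∑ σ : ΩV k n, μ.real {ω | restr (V k n) ω = σ.1} = 1 := by
  have := integral_resV (μ := μ) (n := n) (fun _ => 1)
  simpa using this.symm

lemma zWeight_resV (lam : ℝ) (z : G k → ℝ) (n : ℕ) (t : Ω k) :
    zWeight lam z (resV n t) = (∏ x ∈ V k n, if t.1 x = 1 then lam else 1) *
      ∏ x ∈ W k n, if t.1 x = 1 then z x else 1 := by
  rw [zWeight, ← Finset.prod_coe_sort (V k n), ← Finset.prod_coe_sort (W k n)]
  congr 1
  rw [numOcc, Finset.prod_ite, Finset.prod_const_one, mul_one, Finset.prod_const]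
  rfl

end Cylinder

/-! ## Tree-indexed Markov chains -/

section Chain

variable {k : ℕ}

/-- The probability measure on `{0, 1}` with odds `q : 1` for the value `1`. -/
noncomputable def bern (q : ℝ≥0) : Measure (Fin 2) :=
  (1 + q)⁻¹ • Measure.dirac 0 + (q / (1 + q)) • Measure.dirac 1

instance (q : ℝ≥0) : IsProbabilityMeasure (bern q) := by
  constructor
  have h : (1 + q)⁻¹ + q / (1 + q) = 1 := by
    have : 1 + q ≠ 0 := by positivity
    field_simp
  simp only [bern, Measure.add_apply, Measure.smul_apply, measure_univ]
  rw [ENNReal.smul_def, ENNReal.smul_def, smul_eq_mul, smul_eq_mul, mul_one, mul_one,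
    ← ENNReal.coe_add, h, ENNReal.coe_one]

lemma bern_real_singleton (q : ℝ≥0) (v : Fin 2) :
    (bern q).real {v} = (if v = 1 then (q : ℝ) else 1) * (1 + (q : ℝ))⁻¹ := by
  rw [bern, measureReal_add_apply, measureReal_nnreal_smul_apply, measureReal_nnreal_smul_apply]
  fin_cases v <;> simp [Measure.real, div_eq_mul_inv]

/-- `x` is not blocked by an occupied parent. -/
def Free (t : G k → Fin 2) (x : G k) : Prop := x = 1 ∨ t (parent x) ≠ 1

open Classical in
/-- The configuration obtained from independent proposals `B` by rejecting, from the root upwards,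
the proposals whose parent is occupied. -/
noncomputable def chain (B : G k → Fin 2) (x : G k) : Fin 2 :=
  if _h : x = 1 then B x else if chain B (parent x) = 1 then 0 else B x
termination_by len x
decreasing_by exact len_parent_lt _h

open Classical in
lemma chain_eq (B : G k → Fin 2) (x : G k) :
    chain B x = if Free (chain B) x then B x else 0 := by
  rw [chain]
  by_cases h : x = 1
  · simp [h, Free]
  · by_cases h2 : chain B (parent x) = 1 <;> simp [h, h2, Free]

lemma chain_admissible (B : G k → Fin 2) (x y : G k) (h : (tree k).Adj x y) :
    ¬ (chain B x = 1 ∧ chain B y = 1) := by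
  classical
  have key : ∀ x : G k, x ≠ 1 → ¬ (chain B x = 1 ∧ chain B (parent x) = 1) := by
    rintro x hx ⟨h1, h2⟩
    rw [chain_eq, if_neg (by simp [Free, hx, h2])] at h1
    simp at h1
  rcases adj_iff_parent.1 h with ⟨hx, rfl⟩ | ⟨hy, rfl⟩
  · exact key x hx
  · exact fun h => key y hy h.symm

lemma measurable_chain_apply (x : G k) : Measurable (fun B : G k → Fin 2 => chain B x) := by
  classical
  suffices H : ∀ n (x : G k), len x = n → Measurable (fun B : G k → Fin 2 => chain B x) from
    H _ x rfl
  intro n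
  induction n using Nat.strong_induction_on with
  | _ n ih =>
    rintro x rfl
    by_cases h : x = 1
    · have : (fun B : G k → Fin 2 => chain B x) = fun B => B x := by
        funext B; rw [chain]; simp [h]
      rw [this]
      exact measurable_pi_apply x
    · have : (fun B : G k → Fin 2 => chain B x) =
          fun B => if chain B (parent x) = 1 then 0 else B x := by
        funext B; rw [chain]; simp [h]
      rw [this]
      exact Measurable.ite (ih _ (len_parent_lt h) _ rfl (measurableSet_singleton 1))
        measurable_const (measurable_pi_apply x)

/-- `chain` as a map into the space of admissible configurations. -/
noncomputable def chainΩ (B : G k → Fin 2) : Ω k := ⟨chain B, chain_admissible B⟩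

lemma measurable_chainΩ : Measurable (chainΩ (k := k)) :=
  (measurable_pi_lambda _ measurable_chain_apply).subtype_mk

/-- The Markov chain on the tree whose occupation odds at unblocked vertices are
`λ z_x : 1`. -/
noncomputable def chainMeasure (lam : ℝ) (z : G k → ℝ) : Measure (Ω k) :=
  (Measure.infinitePi (fun x => bern (lam * z x).toNNReal)).map chainΩ

instance (lam : ℝ) (z : G k → ℝ) : IsProbabilityMeasure (chainMeasure lam z) :=
  Measure.isProbabilityMeasure_map measurable_chainΩ.aemeasurable

/-- At a blocked vertex both the chain and `t` are vacant, so the proposal there is unconstrained;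
the rest is induction away from the root. -/
lemma chain_agree_iff (B : G k → Fin 2) (t : Ω k) (n : ℕ) :
    (∀ x ∈ V k n, chain B x = t.1 x) ↔ ∀ x ∈ V k n, Free t.1 x → B x = t.1 x := by
  classical
  have hpar : ∀ x ∈ V k n, x ≠ 1 → parent x ∈ V k n := by
    intro x hx h1
    rw [mem_V] at *
    have := len_parent_lt h1
    omega
  constructor
  · intro h x hx hf
    have hf' : Free (chain B) x := by
      rcases hf with hf | hf
      · exact Or.inl hf
      · by_cases h1 : x = 1
        · exact Or.inl h1
        · exact Or.inr (by rw [h _ (hpar x hx h1)]; exact hf)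
    rw [← h x hx, chain_eq, if_pos hf']
  · intro h
    suffices H : ∀ m (x : G k), len x = m → x ∈ V k n → chain B x = t.1 x from
      fun x hx => H _ x rfl hx
    intro m
    induction m using Nat.strong_induction_on with
    | _ m ih =>
      rintro x rfl hx
      rw [chain_eq]
      by_cases h1 : x = 1
      · rw [if_pos (show Free _ _ from Or.inl h1)]
        exact h x hx (Or.inl h1)
      · have h2 := ih _ (len_parent_lt h1) _ rfl (hpar x hx h1)
        by_cases hp : t.1 (parent x) = 1
        · rw [if_neg (by simp [Free, h1, h2, hp])]
          have := t.2 _ _ (adj_parent h1)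
          omega
        · rw [if_pos (show Free _ _ from Or.inr (by rwa [h2]))]
          exact h x hx (Or.inr hp)

-- By `chain_agree_iff` the preimage of a cylinder is a box in the proposals, so independence gives
-- a product over the free vertices.
open Classical in
lemma chainMeasure_cylinder {lam : ℝ} (hlam : 0 ≤ lam) {z : G k → ℝ} (hz : ∀ x, 0 ≤ z x)
    (n : ℕ) (t : Ω k) :
    (chainMeasure lam z).real {ω | restr (V k n) ω = (resV n t).1} =
      ∏ x ∈ V k n, if Free t.1 x then (if t.1 x = 1 then lam * z x else 1) * (1 + lam * z x)⁻¹
        else 1 := by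
  have hset : chainΩ ⁻¹' {ω : Ω k | restr (V k n) ω = (resV n t).1} =
      Set.pi (V k n) (fun x => if Free t.1 x then {t.1 x} else Set.univ) := by
    ext B
    rw [Set.mem_preimage, Set.mem_ofPred_eq, restr_eq_iff, resV_eq_iff]
    refine (chain_agree_iff B t n).trans ?_
    rw [Set.mem_pi]
    refine forall₂_congr fun x _ => ?_
    by_cases hf : Free t.1 x <;> simp [hf]
  rw [chainMeasure, map_measureReal_apply measurable_chainΩ (measurableSet_cylinder _), hset,
    Measure.real, Measure.infinitePi_pi, ENNReal.toReal_prod]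
  · refine Finset.prod_congr rfl fun x _ => ?_
    by_cases hf : Free t.1 x
    · rw [if_pos hf, if_pos hf]
      change (bern _).real _ = _
      rw [bern_real_singleton, Real.coe_toNNReal _ (mul_nonneg hlam (hz x))]
    · rw [if_neg hf, if_neg hf, measure_univ, ENNReal.toReal_one]
  · intro x _
    exact MeasurableSet.of_discrete

open Classical in
/-- Regrouping the blocked vertices by their parents. -/
lemma prod_blocked (q : G k → ℝ) (n : ℕ) (t : Ω k) :
    (∏ x ∈ V k n, if Free t.1 x then 1 else q x) =
      ∏ x ∈ V k n with len x < n, if t.1 x = 1 then ∏ y ∈ children x, q y else 1 := by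
  have h1 : (∏ x ∈ V k n, if Free t.1 x then 1 else q x) =
      ∏ x ∈ V k n with x ≠ 1, if t.1 (parent x) = 1 then q x else 1 := by
    rw [Finset.prod_filter]
    refine Finset.prod_congr rfl fun x _ => ?_
    by_cases hx : x = 1
    · simp [hx, Free]
    · by_cases h2 : t.1 (parent x) = 1 <;> simp [hx, h2, Free]
  rw [h1, ← Finset.prod_fiberwise_of_maps_to (s := {x ∈ V k n | x ≠ 1})
    (t := {x ∈ V k n | len x < n}) (g := parent)]
  · refine Finset.prod_congr rfl fun x hx => ?_
    rw [Finset.mem_filter] at hx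
    have h2 : {y ∈ {x ∈ V k n | x ≠ 1} | parent y = x} = children x := by
      ext y
      rw [Finset.mem_filter, Finset.mem_filter, mem_children, mem_V]
      refine ⟨fun h => ⟨h.1.2, h.2⟩, fun h => ⟨⟨?_, h.1⟩, h.2⟩⟩
      have := len_parent h.1
      rw [h.2] at this
      omega
    rw [h2]
    split_ifs with ht
    · refine Finset.prod_congr rfl fun y hy => ?_
      rw [(mem_children.1 hy).2, if_pos ht]
    · refine Finset.prod_eq_one fun y hy => ?_
      rw [(mem_children.1 hy).2, if_neg ht]
  · intro x hx
    rw [Finset.mem_filter, mem_V] at *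
    have := len_parent hx.2
    omega

/-- If `z` satisfies the recursion `z_x = ∏_{y child of x} (1 + λ z_y)⁻¹` inside the ball `V_n`,
then the marginal of the chain on `V_n` is given by the weights `zWeight`. -/
theorem chainMeasure_eq_zProb {lam : ℝ} (hlam : 0 ≤ lam) {z : G k → ℝ} (hz : ∀ x, 0 ≤ z x)
    {n : ℕ} (hrec : ∀ x, len x < n → z x = ∏ y ∈ children x, (1 + lam * z y)⁻¹)
    (σ : ΩV k n) :
    (chainMeasure lam z).real {ω | restr (V k n) ω = σ.1} = zProb lam z σ := by
  classical
  have hpos : ∀ x, 0 < 1 + lam * z x := fun x => by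
    have := mul_nonneg hlam (hz x)
    positivity
  set C : ℝ := ∏ x ∈ V k n, (1 + lam * z x)⁻¹ with hC
  have hC0 : C ≠ 0 := (Finset.prod_pos fun x _ => inv_pos.2 (hpos x)).ne'
  -- Proportionality suffices: both sides have total mass one, so the partition function is never
  -- computed.
  have key : ∀ σ : ΩV k n, (chainMeasure lam z).real {ω | restr (V k n) ω = σ.1} =
      C * zWeight lam z σ := by
    intro σ
    obtain ⟨t, rfl⟩ := resV_surjective n σ
    rw [chainMeasure_cylinder hlam hz, zWeight_resV]
    have hblk := prod_blocked (fun x => (1 + lam * z x)⁻¹) n t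
    have hF : (∏ x ∈ V k n, if Free t.1 x then 1 else (1 + lam * z x)⁻¹) ≠ 0 := by
      refine Finset.prod_ne_zero_iff.2 fun x _ => ?_
      split_ifs
      · exact one_ne_zero
      · exact (inv_pos.2 (hpos x)).ne'
    apply mul_right_cancel₀ hF
    have h3 : (∏ x ∈ V k n with len x < n, if t.1 x = 1 then
        ∏ y ∈ children x, (1 + lam * z y)⁻¹ else 1) =
        ∏ x ∈ V k n with len x < n, if t.1 x = 1 then z x else 1 := by
      refine Finset.prod_congr rfl fun x hx => ?_
      rw [hrec x (Finset.mem_filter.1 hx).2]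
    have h4 : (∏ x ∈ V k n with len x < n, if t.1 x = 1 then z x else 1) *
        (∏ x ∈ W k n, if t.1 x = 1 then z x else 1) =
        ∏ x ∈ V k n, if t.1 x = 1 then z x else 1 := by
      have : W k n = {x ∈ V k n | ¬ len x < n} := by
        ext x
        rw [mem_W, Finset.mem_filter, mem_V]
        omega
      rw [this, Finset.prod_filter_mul_prod_filter_not]
    rw [mul_assoc, mul_assoc, hblk, h3, mul_comm (∏ x ∈ W k n, _), h4, ← h3, ← hblk, hC,
      ← Finset.prod_mul_distrib, ← Finset.prod_mul_distrib, ← Finset.prod_mul_distrib]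
    refine Finset.prod_congr rfl fun x _ => ?_
    by_cases hf : Free t.1 x
    · simp only [hf, if_true]
      split_ifs <;> ring
    · have h0 : t.1 x ≠ 1 := by
        intro h1
        rw [Free, not_or, not_not] at hf
        exact t.2 _ _ (adj_parent hf.1) ⟨h1, hf.2⟩
      simp [hf, h0]
  have hsum := sum_real_cylinder (chainMeasure lam z) n
  simp_rw [key, ← Finset.mul_sum] at hsum
  rw [key, zProb, eq_div_iff]
  · rw [mul_right_comm, hsum, one_mul]
  · rintro h0
    rw [h0, mul_zero] at hsum
    exact zero_ne_one hsum

end Chain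

open MeasureTheory

/-! ## Events depending on a ball -/

section Events

variable {k : ℕ}

lemma measurable_resV_mem (n : ℕ) (P : ΩV k n → Prop) : MeasurableSet {ω : Ω k | P (resV n ω)} := by
  have : {ω : Ω k | P (resV n ω)} = ⋃ σ ∈ {σ | P σ}, {ω | restr (V k n) ω = σ.1} := by
    ext ω
    simp only [Set.mem_iUnion, Set.mem_ofPred_eq, restr_eq_iff, exists_prop]
    exact ⟨fun h => ⟨_, h, rfl⟩, fun ⟨σ, h, h2⟩ => h2 ▸ h⟩
  rw [this]
  exact MeasurableSet.biUnion (Set.toFinite _).countable fun σ _ => measurableSet_cylinder σ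

open Classical in
lemma real_resV_mem (μ : Measure (Ω k)) [IsProbabilityMeasure μ] (n : ℕ) (P : ΩV k n → Prop) :
    μ.real {ω | P (resV n ω)} = ∑ σ with P σ, μ.real {ω | restr (V k n) ω = σ.1} := by
  have h := integral_resV (μ := μ) (n := n) (fun σ => if P σ then 1 else 0)
  have h2 : ∫ ω, (if P (resV n ω) then (1 : ℝ) else 0) ∂μ = μ.real {ω | P (resV n ω)} := by
    rw [← integral_indicator_one (measurable_resV_mem n P)]
    rfl
  rw [← h2, h, Finset.sum_filter]
  simp

/-- Agreement of two measures on the cylinders over `V_n` passes to smaller balls. -/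
lemma real_cylinder_eq_of_le {μ ν : Measure (Ω k)} [IsProbabilityMeasure μ]
    [IsProbabilityMeasure ν] {m n : ℕ} (hmn : m ≤ n)
    (h : ∀ σ : ΩV k n, μ.real {ω | restr (V k n) ω = σ.1} = ν.real {ω | restr (V k n) ω = σ.1})
    (τ : ΩV k m) :
    μ.real {ω | restr (V k m) ω = τ.1} = ν.real {ω | restr (V k m) ω = τ.1} := by
  have hset : {ω : Ω k | restr (V k m) ω = τ.1} =
      {ω | ∃ ω' : Ω k, resV n ω' = resV n ω ∧ resV m ω' = τ} := by
    ext ω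
    rw [Set.mem_ofPred_eq, Set.mem_ofPred_eq, restr_eq_iff]
    constructor
    · exact fun h => ⟨ω, rfl, h⟩
    · rintro ⟨ω', h1, rfl⟩
      rw [resV_eq_iff] at *
      exact fun x hx => (h1 x (mem_V.2 ((mem_V.1 hx).trans hmn))).symm
  rw [hset, real_resV_mem μ n (fun σ => ∃ ω' : Ω k, resV n ω' = σ ∧ resV m ω' = τ),
    real_resV_mem ν n (fun σ => ∃ ω' : Ω k, resV n ω' = σ ∧ resV m ω' = τ)]
  exact Finset.sum_congr rfl fun σ _ => h σ

/-- The event that `ω` agrees with `p` on `S`. -/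
def agreeEvent (p : G k → Fin 2) (S : Finset (G k)) : Set (Ω k) := {ω | ∀ x ∈ S, ω.1 x = p x}

/-- The configuration `σ` on `V_n` agrees with `p` on `S`. -/
def AgreesOn (p : G k → Fin 2) (S : Finset (G k)) {n : ℕ} (σ : ΩV k n) : Prop :=
  ∀ x : V k n, (x : G k) ∈ S → σ.1 x = p x

lemma agreeEvent_eq_resV (p : G k → Fin 2) {S : Finset (G k)} {n : ℕ} (hS : S ⊆ V k n) :
    agreeEvent p S = {ω | AgreesOn p S (resV n ω)} := by
  ext ω
  exact ⟨fun h x hx => h x hx, fun h x hx => h ⟨x, hS hx⟩ hx⟩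

lemma exists_subset_V (S : Finset (G k)) : ∃ n, S ⊆ V k n :=
  ⟨S.sup len, fun _ hx => mem_V.2 (Finset.le_sup (f := len) hx)⟩

lemma V_mono {m n : ℕ} (h : m ≤ n) : V k m ⊆ V k n :=
  fun _ hx => mem_V.2 ((mem_V.1 hx).trans h)

lemma measurableSet_agreeEvent (p : G k → Fin 2) (S : Finset (G k)) :
    MeasurableSet (agreeEvent p S) := by
  obtain ⟨n, hn⟩ := exists_subset_V S
  rw [agreeEvent_eq_resV p hn]
  exact measurable_resV_mem n (AgreesOn p S)

/-- Singletons `S` already suffice: a spin has two values, so disagreement at x is the complement of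
agreement. -/
lemma generateFrom_agreeEvent (p : G k → Fin 2) :
    (inferInstance : MeasurableSpace (Ω k)) =
      MeasurableSpace.generateFrom (Set.range (agreeEvent p)) := by
  apply le_antisymm
  · have h1 : @Measurable _ _ (MeasurableSpace.generateFrom (Set.range (agreeEvent p))) _
        (fun ω : Ω k => ω.1) := by
      rw [@measurable_pi_iff]
      intro x
      have h2 : MeasurableSet[MeasurableSpace.generateFrom (Set.range (agreeEvent p))]
          {ω : Ω k | ω.1 x = p x} := by
        refine MeasurableSpace.measurableSet_generateFrom ⟨{x}, ?_⟩
        ext ω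
        simp [agreeEvent]
      refine @measurable_to_countable' _ _ _ _ (MeasurableSpace.generateFrom _) _ fun v => ?_
      by_cases hv : v = p x
      · subst hv
        exact h2
      · have : (fun ω : Ω k => ω.1 x) ⁻¹' {v} = {ω : Ω k | ω.1 x = p x}ᶜ := by
          ext ω
          rw [Set.mem_preimage, Set.mem_singleton_iff, Set.mem_compl_iff, Set.mem_ofPred_eq]
          omega
        rw [this]
        exact @MeasurableSet.compl _ _ (MeasurableSpace.generateFrom _) h2
    exact (measurable_iff_comap_le.1 h1)
  · apply MeasurableSpace.generateFrom_le
    rintro _ ⟨S, rfl⟩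
    exact measurableSet_agreeEvent p S

/-- The events are a π-system, since agreeing on `S` and on `T` is agreeing on `S ∪ T`. -/
lemma ext_of_agreeEvent (p : G k → Fin 2) {μ ν : Measure (Ω k)} [IsProbabilityMeasure μ]
    [IsProbabilityMeasure ν] (h : ∀ S, μ.real (agreeEvent p S) = ν.real (agreeEvent p S)) :
    μ = ν := by
  classical
  refine ext_of_generate_finite _ (generateFrom_agreeEvent p) ?_ ?_ (by simp)
  · rintro _ ⟨S, rfl⟩ _ ⟨T, rfl⟩ _
    refine ⟨S ∪ T, ?_⟩
    ext ω
    simp only [agreeEvent, Finset.mem_union, Set.mem_inter_iff, Set.mem_ofPred_eq]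
    exact ⟨fun h => ⟨fun x hx => h x (Or.inl hx), fun x hx => h x (Or.inr hx)⟩,
      fun h x hx => hx.elim (h.1 x) (h.2 x)⟩
  · rintro _ ⟨S, rfl⟩
    exact (measureReal_eq_measureReal_iff).1 (h S)

/-- A probability measure on `Ω` is determined by its marginals on large balls. -/
lemma ext_of_cylinder {μ ν : Measure (Ω k)} [IsProbabilityMeasure μ] [IsProbabilityMeasure ν]
    (h : ∀ n, 1 ≤ n → ∀ σ : ΩV k n,
      μ.real {ω | restr (V k n) ω = σ.1} = ν.real {ω | restr (V k n) ω = σ.1}) : μ = ν := by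
  classical
  refine ext_of_agreeEvent (fun _ => 0) fun S => ?_
  obtain ⟨n, hn⟩ := exists_subset_V S
  rw [agreeEvent_eq_resV _ (hn.trans (V_mono n.le_succ)),
    real_resV_mem μ _ (AgreesOn _ S), real_resV_mem ν _ (AgreesOn _ S)]
  exact Finset.sum_congr rfl fun σ _ => h _ (by omega) σ

end Events

/-! ## Measures corresponding to a collection -/

section Corresponds

variable {k : ℕ}

lemma zWeight_nonneg {lam : ℝ} (hlam : 0 ≤ lam) {z : G k → ℝ} (hz : ∀ x, 0 ≤ z x) {n : ℕ}
    (σ : ΩV k n) : 0 ≤ zWeight lam z σ := by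
  refine mul_nonneg (pow_nonneg hlam _) (Finset.prod_nonneg fun x _ => ?_)
  split_ifs
  · exact hz x
  · exact zero_le_one

/-- The empty configuration. -/
def emptyΩ (k : ℕ) : Ω k := ⟨fun _ => 0, by simp⟩

open Classical in
/-- The configuration with a single occupied vertex. -/
noncomputable def singleΩ (x : G k) : Ω k :=
  ⟨fun y => if y = x then 1 else 0, by
    rintro y y' h ⟨h1, h2⟩
    have hy : y = x := by by_contra hne; simp [hne] at h1
    have hy' : y' = x := by by_contra hne; simp [hne] at h2
    rw [hy, hy'] at h
    exact h.ne rfl⟩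

lemma zWeight_empty (lam : ℝ) (z : G k → ℝ) (n : ℕ) :
    zWeight lam z (resV n (emptyΩ k)) = 1 := by
  rw [zWeight_resV]
  simp [emptyΩ]

lemma zWeight_single (lam : ℝ) (z : G k → ℝ) (x : G k) :
    zWeight lam z (resV (len x) (singleΩ x)) = lam * z x := by
  classical
  have h1 : ∀ y, (singleΩ x).1 y = 1 ↔ y = x := by
    intro y
    by_cases h : y = x <;> simp [singleΩ, h]
  rw [zWeight_resV]
  simp_rw [h1]
  rw [Finset.prod_ite_eq' , Finset.prod_ite_eq', if_pos (mem_V.2 le_rfl), if_pos (mem_W.2 rfl)]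

lemma sum_zWeight_pos {lam : ℝ} (hlam : 0 ≤ lam) {z : G k → ℝ} (hz : ∀ x, 0 ≤ z x) (n : ℕ) :
    0 < ∑ σ : ΩV k n, zWeight lam z σ :=
  Finset.sum_pos' (fun σ _ => zWeight_nonneg hlam hz σ)
    ⟨resV n (emptyΩ k), Finset.mem_univ _, by rw [zWeight_empty]; exact one_pos⟩

lemma zProb_congr {lam : ℝ} {z z' : G k → ℝ} {n : ℕ} (h : ∀ x, len x = n → z x = z' x)
    (σ : ΩV k n) : zProb lam z σ = zProb lam z' σ := by
  have : ∀ σ : ΩV k n, zWeight lam z σ = zWeight lam z' σ := by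
    intro σ
    unfold zWeight
    congr 1
    refine Finset.prod_congr rfl fun x _ => ?_
    rw [h x (mem_W.1 x.2)]
  unfold zProb
  simp_rw [this]

/-- The marginal on `V_n` determines `z` on the sphere `W_n`. -/
lemma eq_of_zProb_eq {lam : ℝ} (hlam : 0 < lam) {z z' : G k → ℝ} (hz : ∀ x, 0 ≤ z x)
    (hz' : ∀ x, 0 ≤ z' x) (x : G k)
    (h : ∀ σ : ΩV k (len x), zProb lam z σ = zProb lam z' σ) : z x = z' x := by
  have h0 := h (resV (len x) (emptyΩ k))
  have h1 := h (resV (len x) (singleΩ x))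
  have hp := sum_zWeight_pos hlam.le hz (len x)
  have hp' := sum_zWeight_pos hlam.le hz' (len x)
  rw [zProb, zProb, zWeight_empty, zWeight_empty, div_eq_div_iff hp.ne' hp'.ne', one_mul,
    one_mul] at h0
  rw [zProb, zProb, zWeight_single, zWeight_single, h0] at h1
  -- The empty configuration has weight one, which equates the partition functions; the
  -- single-particle weights λ z_x then compare directly.
  have h2 := (div_left_inj' hp.ne').1 h1
  exact mul_left_cancel₀ hlam.ne' h2

lemma Corresponds.eq_of_ne_one {lam : ℝ} (hlam : 0 < lam) {z z' : G k → ℝ} {μ : Measure (Ω k)}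
    (h : Corresponds lam z μ) (h' : Corresponds lam z' μ) {x : G k} (hx : x ≠ 1) :
    z x = z' x := by
  have hn : 1 ≤ len x := Nat.one_le_iff_ne_zero.2 (mt len_eq_zero_iff.1 hx)
  exact eq_of_zProb_eq hlam (fun y => (h.1 y).le) (fun y => (h'.1 y).le) x fun σ => by
    rw [← h.2.2 _ hn, ← h'.2.2 _ hn]

lemma Corresponds.measure_eq {lam : ℝ} {z z' : G k → ℝ} {μ ν : Measure (Ω k)}
    (h : Corresponds lam z μ) (h' : Corresponds lam z' ν) (hz : ∀ x, x ≠ 1 → z x = z' x) :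
    μ = ν := by
  have := h.2.1
  have := h'.2.1
  refine ext_of_cylinder fun n hn σ => ?_
  rw [h.2.2 n hn, h'.2.2 n hn]
  refine zProb_congr (fun x hx => hz x ?_) σ
  rintro rfl
  rw [len_one] at hx
  omega

/-- The recursion `z ↦ (x ↦ ∏_{y child of x} (1 + λ z_y)⁻¹)`. -/
noncomputable def recStep (lam : ℝ) (z : G k → ℝ) (x : G k) : ℝ :=
  ∏ y ∈ children x, (1 + lam * z y)⁻¹

lemma recStep_nonneg {lam : ℝ} (hlam : 0 ≤ lam) {z : G k → ℝ} (hz : ∀ x, 0 ≤ z x) (x : G k) :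
    0 ≤ recStep lam z x := by
  refine Finset.prod_nonneg fun y _ => inv_nonneg.2 ?_
  have := mul_nonneg hlam (hz y)
  positivity

/-- The collection that agrees with `z` on `W_n` and satisfies the recursion inside `V_n`. -/
noncomputable def backward (lam : ℝ) (z : G k → ℝ) (n : ℕ) (x : G k) : ℝ :=
  (recStep lam)^[n - len x] z x

lemma backward_nonneg {lam : ℝ} (hlam : 0 ≤ lam) {z : G k → ℝ} (hz : ∀ x, 0 ≤ z x) (n : ℕ)
    (x : G k) : 0 ≤ backward lam z n x := by
  suffices H : ∀ i (u : G k), 0 ≤ (recStep lam)^[i] z u from H _ x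
  intro i
  induction i with
  | zero => exact hz
  | succ i ih =>
    intro u
    rw [Function.iterate_succ_apply']
    exact recStep_nonneg hlam ih u

lemma backward_of_le {lam : ℝ} {z : G k → ℝ} {n : ℕ} {x : G k} (h : n ≤ len x) :
    backward lam z n x = z x := by
  rw [backward, Nat.sub_eq_zero_of_le h, Function.iterate_zero, id]

lemma backward_of_lt {lam : ℝ} {z : G k → ℝ} {n : ℕ} {x : G k} (h : len x < n) :
    backward lam z n x = ∏ y ∈ children x, (1 + lam * backward lam z n y)⁻¹ := by
  obtain ⟨i, hi⟩ : ∃ i, n - len x = i + 1 := ⟨n - len x - 1, by omega⟩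
  rw [backward, hi, Function.iterate_succ_apply', recStep]
  refine Finset.prod_congr rfl fun y hy => ?_
  rw [backward, show n - len y = i by rw [len_of_mem_children hy]; omega]

/-- The marginals of the chain built backwards from `z` on `W_n`. -/
lemma chainMeasure_backward {lam : ℝ} (hlam : 0 ≤ lam) {z : G k → ℝ} (hz : ∀ x, 0 ≤ z x)
    {m n : ℕ} (hmn : m ≤ n) (σ : ΩV k m) :
    (chainMeasure lam (backward lam z n)).real {ω | restr (V k m) ω = σ.1} =
      zProb lam (backward lam z n) σ :=
  chainMeasure_eq_zProb hlam (backward_nonneg hlam hz n)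
    (fun _ hx => backward_of_lt (hx.trans_le hmn)) σ

lemma chainMeasure_backward_top {lam : ℝ} (hlam : 0 ≤ lam) {z : G k → ℝ} (hz : ∀ x, 0 ≤ z x)
    {n : ℕ} (σ : ΩV k n) :
    (chainMeasure lam (backward lam z n)).real {ω | restr (V k n) ω = σ.1} = zProb lam z σ := by
  rw [chainMeasure_backward hlam hz le_rfl]
  exact zProb_congr (fun x hx => backward_of_le hx.ge) σ

/-- A collection to which a measure corresponds satisfies the tree recursion. -/
lemma Corresponds.recursion {lam : ℝ} (hlam : 0 < lam) {z : G k → ℝ} {μ : Measure (Ω k)}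
    (h : Corresponds lam z μ) {x : G k} (hx : x ≠ 1) :
    z x = ∏ y ∈ children x, (1 + lam * z y)⁻¹ := by
  have := h.2.1
  have hz : ∀ x, 0 ≤ z x := fun x => (h.1 x).le
  have hn : 1 ≤ len x := Nat.one_le_iff_ne_zero.2 (mt len_eq_zero_iff.1 hx)
  -- The chain built from `z` on the next sphere has the same marginal on that larger ball as `μ`,
  -- hence on the smaller one, where both are described by a collection; such a collection is unique
  -- on the sphere.
  have h1 : z x = backward lam z (len x + 1) x := by
    refine eq_of_zProb_eq hlam hz (backward_nonneg hlam.le hz _) x fun σ => ?_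
    rw [← h.2.2 _ hn, ← chainMeasure_backward hlam.le hz (Nat.le_succ _)]
    refine real_cylinder_eq_of_le (Nat.le_succ _) (fun τ => ?_) σ
    rw [h.2.2 _ (by omega), chainMeasure_backward_top hlam.le hz]
  rw [h1, backward_of_lt (Nat.lt_succ_self _)]
  refine Finset.prod_congr rfl fun y hy => ?_
  rw [backward_of_le (len_of_mem_children hy).ge]

/-- A positive solution of the tree recursion has a corresponding measure. -/
lemma corresponds_chainMeasure {lam : ℝ} (hlam : 0 < lam) {z : G k → ℝ} (hz : ∀ x, 0 < z x)
    (hrec : ∀ x, x ≠ 1 → z x = ∏ y ∈ children x, (1 + lam * z y)⁻¹) :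
    ∃ μ, Corresponds lam z μ := by
  classical
  have hpos : ∀ x, 0 < 1 + lam * z x := fun x => by
    have := mul_pos hlam (hz x)
    positivity
  -- The chain needs the recursion at the root too, so the root value is redefined; marginals with n
  -- ≥ 1 do not see the change.
  let z' : G k → ℝ := fun x => if x = 1 then ∏ y ∈ children x, (1 + lam * z y)⁻¹ else z x
  have hz'1 : ∀ x, x ≠ 1 → z' x = z x := fun x hx => if_neg hx
  have hz' : ∀ x, 0 ≤ z' x := by
    intro x
    by_cases hx : x = 1
    · rw [show z' x = _ from if_pos hx]
      exact Finset.prod_nonneg fun y _ => (inv_pos.2 (hpos y)).le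
    · rw [hz'1 x hx]
      exact (hz x).le
  have hrec' : ∀ x, z' x = ∏ y ∈ children x, (1 + lam * z' y)⁻¹ := by
    intro x
    have h1 : ∏ y ∈ children x, (1 + lam * z' y)⁻¹ = ∏ y ∈ children x, (1 + lam * z y)⁻¹ :=
      Finset.prod_congr rfl fun y hy => by rw [hz'1 y (mem_children.1 hy).1]
    rw [h1]
    by_cases hx : x = 1
    · exact if_pos hx
    · rw [hz'1 x hx, hrec x hx]
  refine ⟨chainMeasure lam z', hz, inferInstance, fun n hn σ => ?_⟩
  rw [chainMeasure_eq_zProb hlam.le hz' fun x _ => hrec' x]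
  refine zProb_congr (fun x hx => hz'1 x ?_) σ
  rintro rfl
  rw [len_one] at hx
  omega

end Corresponds

open MeasureTheory

/-! ## The DLR equations for measures corresponding to a collection -/

section DLR

variable {k : ℕ}

/-- The restriction of a configuration on `V_{n+1}` to the sphere `W_{n+1}`. -/
noncomputable def outer {n : ℕ} (τ : V k (n + 1) → Fin 2) : W k (n + 1) → Fin 2 :=
  fun x => τ ⟨x, W_subset_V k (n + 1) x.2⟩

/-- The restriction of a configuration on `V_{n+1}` to the ball `V_n`. -/
noncomputable def inner {n : ℕ} (τ : ΩV k (n + 1)) : ΩV k n :=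
  ⟨fun x => τ.1 ⟨x, V_mono n.le_succ x.2⟩, fun x y h =>
    τ.2 ⟨x, V_mono n.le_succ x.2⟩ ⟨y, V_mono n.le_succ y.2⟩ h⟩

lemma join_inner_outer {n : ℕ} (τ : ΩV k (n + 1)) : join (inner τ).1 (outer τ.1) = τ.1 := by
  funext x
  simp only [join, inner, outer]
  split_ifs <;> rfl

lemma join_apply_V {n : ℕ} (σ : V k n → Fin 2) (η : W k (n + 1) → Fin 2) (x : V k n) :
    join σ η ⟨x, V_mono n.le_succ x.2⟩ = σ x := by
  simp only [join]
  rw [dif_pos x.2]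

lemma join_apply_W {n : ℕ} (σ : V k n → Fin 2) (η : W k (n + 1) → Fin 2) (x : W k (n + 1)) :
    join σ η ⟨x, W_subset_V k (n + 1) x.2⟩ = η x := by
  simp only [join]
  rw [dif_neg]
  rw [mem_V, mem_W.1 x.2]
  omega

/-- The weight `∏_{x ∈ W_{n+1}} (λ z_x)^{η(x)}` of a boundary configuration. -/
noncomputable def outerWeight {n : ℕ} (lam : ℝ) (z : G k → ℝ) (η : W k (n + 1) → Fin 2) : ℝ :=
  ∏ x : W k (n + 1), if η x = 1 then lam * z x else 1

lemma zWeight_succ (lam : ℝ) (z : G k → ℝ) {n : ℕ} (τ : ΩV k (n + 1)) :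
    zWeight lam z τ = outerWeight lam z (outer τ.1) * lam ^ numOcc (inner τ).1 := by
  classical
  obtain ⟨t, rfl⟩ := resV_surjective (n + 1) τ
  have h1 : inner (resV (n + 1) t) = resV n t := rfl
  have h2 : lam ^ numOcc (resV n t).1 = ∏ x ∈ V k n, if t.1 x = 1 then lam else 1 := by
    rw [← Finset.prod_coe_sort (V k n), numOcc, Finset.prod_ite, Finset.prod_const_one, mul_one,
      Finset.prod_const]
    rfl
  have h3 : outerWeight lam z (outer (resV (n + 1) t).1) =
      ∏ x ∈ W k (n + 1), if t.1 x = 1 then lam * z x else 1 := by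
    rw [← Finset.prod_coe_sort (W k (n + 1))]
    rfl
  have h4 : V k (n + 1) = V k n ∪ W k (n + 1) := by
    ext x
    rw [Finset.mem_union, mem_V, mem_V, mem_W]
    omega
  have h5 : Disjoint (V k n) (W k (n + 1)) := by
    rw [Finset.disjoint_left]
    intro x hx hx'
    rw [mem_V] at hx
    rw [mem_W] at hx'
    omega
  rw [zWeight_resV, h1, h2, h3, h4, Finset.prod_union h5, mul_assoc, mul_comm,
    ← Finset.prod_mul_distrib]
  congr 1
  refine Finset.prod_congr rfl fun x _ => ?_
  split_ifs <;> simp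

/-- A weighted sum over the configurations on `V_{n+1}` as a double sum. -/
lemma sum_zWeight_succ (lam : ℝ) (z : G k → ℝ) {n : ℕ}
    (Φ : ΩV k n → (W k (n + 1) → Fin 2) → ℝ) :
    ∑ τ : ΩV k (n + 1), Φ (inner τ) (outer τ.1) * zWeight lam z τ =
      ∑ η, ∑ σ, Φ σ η * (outerWeight lam z η * bdryWeight lam σ η) := by
  classical
  rw [← Finset.sum_product', ← Finset.sum_filter_of_ne
    (p := fun p : (W k (n + 1) → Fin 2) × ΩV k n =>
      Admissible (V k (n + 1) : Set (G k)) (join p.2.1 p.1))]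
  · refine Finset.sum_bij (fun τ _ => (outer τ.1, inner τ)) ?_ ?_ ?_ ?_
    · intro τ _
      rw [Finset.mem_filter]
      refine ⟨by simp, ?_⟩
      simp only
      rw [join_inner_outer]
      exact τ.2
    · intro τ _ τ' _ h
      rw [Prod.ext_iff] at h
      apply Subtype.ext
      simp only at h
      rw [← join_inner_outer τ, ← join_inner_outer τ', h.1, h.2]
    · rintro ⟨η, σ⟩ h
      rw [Finset.mem_filter] at h
      refine ⟨⟨join σ.1 η, h.2⟩, Finset.mem_univ _, ?_⟩
      refine Prod.ext (funext fun x => join_apply_W _ _ x)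
        (Subtype.ext (funext fun x => join_apply_V _ _ x))
    · intro τ _
      simp only
      rw [zWeight_succ, bdryWeight, join_inner_outer, if_pos τ.2]
  · rintro ⟨η, σ⟩ _ h
    by_contra hadm
    simp only at h hadm
    rw [bdryWeight, if_neg hadm] at h
    simp at h

lemma bdryWeight_nonneg {lam : ℝ} (hlam : 0 ≤ lam) {n : ℕ} (σ : ΩV k n)
    (η : W k (n + 1) → Fin 2) : 0 ≤ bdryWeight lam σ η := by
  unfold bdryWeight
  split_ifs
  · exact pow_nonneg hlam _
  · exact le_rfl

/-- Valid even for a zero denominator: a vanishing sum of nonnegative weights has vanishing terms.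
-/
lemma condProb_mul_sum {lam : ℝ} (hlam : 0 ≤ lam) {n : ℕ} (σ : ΩV k n)
    (η : W k (n + 1) → Fin 2) :
    condProb lam σ η * ∑ τ : ΩV k n, bdryWeight lam τ η = bdryWeight lam σ η := by
  refine div_mul_cancel_of_imp fun h => ?_
  exact (Finset.sum_eq_zero_iff_of_nonneg fun τ _ => bdryWeight_nonneg hlam τ η).1 h σ
    (Finset.mem_univ _)

/-- The weight on V_{n+1} factors as a function of the boundary η times `bdryWeight`, so the
conditional law inside given η is `condProb`, whatever `z` is. -/
theorem Corresponds.mem_gibbsMeasures {lam : ℝ} (hlam : 0 < lam) {z : G k → ℝ}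
    {μ : Measure (Ω k)} (h : Corresponds lam z μ) : μ ∈ gibbsMeasures k lam := by
  classical
  have := h.2.1
  refine ⟨h.2.1, fun n σ => ?_⟩
  have h1 := integral_resV (μ := μ) (n := n + 1) (fun τ => condProb lam σ (outer τ.1))
  have h2 := integral_resV (μ := μ) (n := n + 1) (fun τ => if inner τ = σ then (1 : ℝ) else 0)
  have h3 : ∫ ω, (if inner (resV (n + 1) ω) = σ then (1 : ℝ) else 0) ∂μ =
      μ.real {ω | restr (V k n) ω = σ.1} := by
    rw [← integral_indicator_one (measurableSet_cylinder σ)]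
    congr 1
    funext ω
    simp only [Set.indicator, Set.mem_ofPred_eq, restr_eq_iff]
    rfl
  have key : ∀ Φ : ΩV k n → (W k (n + 1) → Fin 2) → ℝ,
      ∑ τ : ΩV k (n + 1), Φ (inner τ) (outer τ.1) * μ.real {ω | restr (V k (n + 1)) ω = τ.1} =
      (∑ η, ∑ σ, Φ σ η * (outerWeight lam z η * bdryWeight lam σ η)) /
        ∑ τ : ΩV k (n + 1), zWeight lam z τ := by
    intro Φ
    rw [← sum_zWeight_succ, Finset.sum_div]
    refine Finset.sum_congr rfl fun τ _ => ?_
    rw [h.2.2 _ (by omega), zProb, mul_div_assoc]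
  rw [← h3, h2, key fun σ' _ => if σ' = σ then (1 : ℝ) else 0]
  refine Eq.trans ?_ h1.symm
  rw [key fun _ η => condProb lam σ η]
  congr 1
  refine Finset.sum_congr rfl fun η _ => ?_
  simp only [ite_mul, one_mul, zero_mul, Finset.sum_ite_eq', Finset.mem_univ, if_true]
  rw [← Finset.mul_sum, ← Finset.mul_sum, mul_left_comm, condProb_mul_sum hlam.le]

end DLR

/-! ## Comparison of boundary conditions -/

section Comparison

variable {k : ℕ} {n : ℕ}

open Classical in
/-- The configuration on `V_n` that agrees with `p` exactly on `s`. -/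
noncomputable def agreeConf (p : G k → Fin 2) (s : Finset (V k n)) : V k n → Fin 2 :=
  fun x => if x ∈ s then p x else 1 - p x

/-- `p` takes different values at neighbouring vertices. -/
def IsChessboard (p : G k → Fin 2) : Prop := ∀ x y, (tree k).Adj x y → p x ≠ p y

lemma agreeConf_eq_one_iff_of_one {p : G k → Fin 2} {s : Finset (V k n)} {x : V k n}
    (hx : p x = 1) : agreeConf p s x = 1 ↔ x ∈ s := by
  by_cases h : x ∈ s <;> simp [agreeConf, h, hx]

lemma agreeConf_eq_one_iff_of_ne {p : G k → Fin 2} {s : Finset (V k n)} {x : V k n}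
    (hx : p x ≠ 1) : agreeConf p s x = 1 ↔ x ∉ s := by
  have h0 : p x = 0 := by omega
  by_cases h : x ∈ s <;> simp [agreeConf, h, h0]

/-- At a `p`-occupied vertex agreement means occupied, at its neighbours it means vacant. Exclusion
thus becomes an implication between memberships in `s`, stable under unions and intersections. -/
lemma admissible_agreeConf_iff {p : G k → Fin 2} (hp : IsChessboard p) {s : Finset (V k n)} :
    Admissible (V k n : Set (G k)) (agreeConf p s) ↔
      ∀ x y : V k n, (tree k).Adj x y → p x = 1 → x ∈ s → y ∈ s := by
  constructor
  · intro h x y hxy hx hs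
    by_contra hy
    refine h x y hxy ⟨(agreeConf_eq_one_iff_of_one hx).2 hs, ?_⟩
    exact (agreeConf_eq_one_iff_of_ne fun h1 => hp _ _ hxy (hx.trans h1.symm)).2 hy
  · rintro h x y hxy ⟨hx, hy⟩
    by_cases h1 : p x = 1
    · have h2 : p y ≠ 1 := fun h2 => hp _ _ hxy (h1.trans h2.symm)
      exact (agreeConf_eq_one_iff_of_ne h2).1 hy
        (h x y hxy h1 ((agreeConf_eq_one_iff_of_one h1).1 hx))
    · have h2 : p y = 1 := by
        have := hp _ _ hxy
        omega
      exact (agreeConf_eq_one_iff_of_ne h1).1 hx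
        (h y x hxy.symm h2 ((agreeConf_eq_one_iff_of_one h2).1 hy))

open Classical in
/-- The free-boundary weight in terms of the set of agreement with `p`. -/
noncomputable def agreeWeight (lam : ℝ) (p : G k → Fin 2) (s : Finset (V k n)) : ℝ :=
  if Admissible (V k n : Set (G k)) (agreeConf p s) then lam ^ numOcc (agreeConf p s) else 0

lemma agreeWeight_nonneg {lam : ℝ} (hlam : 0 ≤ lam) (p : G k → Fin 2) (s : Finset (V k n)) :
    0 ≤ agreeWeight lam p s := by
  unfold agreeWeight
  split_ifs
  · exact pow_nonneg hlam _
  · exact le_rfl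

lemma pow_numOcc (lam : ℝ) (σ : V k n → Fin 2) :
    lam ^ numOcc σ = ∏ x, if σ x = 1 then lam else 1 := by
  rw [numOcc, Finset.prod_ite, Finset.prod_const_one, mul_one, Finset.prod_const]

-- The FKG lattice condition. For admissible `a`, `b` it is an equality, the number of occupied
-- vertices being modular in the agreement set.
open Classical in
lemma agreeWeight_mul_le {lam : ℝ} (hlam : 0 ≤ lam) {p : G k → Fin 2} (hp : IsChessboard p)
    (a b : Finset (V k n)) :
    agreeWeight lam p a * agreeWeight lam p b ≤
      agreeWeight lam p (a ⊓ b) * agreeWeight lam p (a ⊔ b) := by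
  by_cases ha : Admissible (V k n : Set (G k)) (agreeConf p a)
  swap
  · rw [agreeWeight, if_neg ha, zero_mul]
    exact mul_nonneg (agreeWeight_nonneg hlam _ _) (agreeWeight_nonneg hlam _ _)
  by_cases hb : Admissible (V k n : Set (G k)) (agreeConf p b)
  swap
  · rw [mul_comm, agreeWeight, if_neg hb, zero_mul]
    exact mul_nonneg (agreeWeight_nonneg hlam _ _) (agreeWeight_nonneg hlam _ _)
  have hab : Admissible (V k n : Set (G k)) (agreeConf p (a ⊓ b)) := by
    rw [admissible_agreeConf_iff hp] at *
    intro x y hxy hx hs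
    simp only [Finset.inf_eq_inter, Finset.mem_inter] at *
    exact ⟨ha x y hxy hx hs.1, hb x y hxy hx hs.2⟩
  have hab' : Admissible (V k n : Set (G k)) (agreeConf p (a ⊔ b)) := by
    rw [admissible_agreeConf_iff hp] at *
    intro x y hxy hx hs
    simp only [Finset.sup_eq_union, Finset.mem_union] at *
    exact hs.imp (ha x y hxy hx) (hb x y hxy hx)
  rw [agreeWeight, agreeWeight, agreeWeight, agreeWeight, if_pos ha, if_pos hb, if_pos hab,
    if_pos hab', pow_numOcc, pow_numOcc, pow_numOcc, pow_numOcc, ← Finset.prod_mul_distrib,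
    ← Finset.prod_mul_distrib]
  refine le_of_eq (Finset.prod_congr rfl fun x _ => ?_)
  by_cases hx : p x = 1
  · simp only [agreeConf_eq_one_iff_of_one hx, Finset.inf_eq_inter, Finset.sup_eq_union,
      Finset.mem_inter, Finset.mem_union]
    by_cases h1 : x ∈ a <;> by_cases h2 : x ∈ b <;> simp [h1, h2]
  · simp only [agreeConf_eq_one_iff_of_ne hx, Finset.inf_eq_inter, Finset.sup_eq_union,
      Finset.mem_inter, Finset.mem_union]
    by_cases h1 : x ∈ a <;> by_cases h2 : x ∈ b <;> simp [h1, h2]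

open Classical in
lemma sum_agreeConf (lam : ℝ) (p : G k → Fin 2) (Φ : (V k n → Fin 2) → ℝ) :
    ∑ σ : ΩV k n, lam ^ numOcc σ.1 * Φ σ.1 =
      ∑ s : Finset (V k n), agreeWeight lam p s * Φ (agreeConf p s) := by
  have h1 : ∀ s : Finset (V k n), agreeWeight lam p s * Φ (agreeConf p s) =
      if Admissible (V k n : Set (G k)) (agreeConf p s) then
        lam ^ numOcc (agreeConf p s) * Φ (agreeConf p s) else 0 := by
    intro s
    rw [agreeWeight, ite_mul, zero_mul]
  simp_rw [h1]
  rw [← Finset.sum_filter]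
  have hconf : ∀ σ : V k n → Fin 2,
      agreeConf p (Finset.univ.filter fun x => σ x = p x) = σ := by
    intro σ
    funext x
    by_cases h : σ x = p x
    · simp [agreeConf, h]
    · simp only [agreeConf, Finset.mem_filter, Finset.mem_univ, true_and, h, if_false]
      omega
  refine Finset.sum_bij (fun σ _ => Finset.univ.filter fun x => σ.1 x = p x) ?_ ?_ ?_ ?_
  · intro σ _
    rw [Finset.mem_filter, hconf]
    exact ⟨Finset.mem_univ _, σ.2⟩
  · intro σ _ σ' _ h
    apply Subtype.ext
    rw [← hconf σ.1, ← hconf σ'.1, h]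
  · intro s hs
    refine ⟨⟨agreeConf p s, (Finset.mem_filter.1 hs).2⟩, Finset.mem_univ _, ?_⟩
    ext x
    rw [Finset.mem_filter, and_iff_right (Finset.mem_univ _)]
    by_cases h : x ∈ s
    · simp [agreeConf, h]
    · simp only [agreeConf, h, if_false, iff_false]
      omega
  · intro σ _
    rw [hconf]

/-- The boundary condition `η` is compatible with `σ`. -/
def Compatible (σ : V k n → Fin 2) (η : W k (n + 1) → Fin 2) : Prop :=
  ∀ (x : V k n) (y : W k (n + 1)), (tree k).Adj x y → ¬ (σ x = 1 ∧ η y = 1)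

open Classical in
lemma bdryWeight_eq {lam : ℝ} (σ : ΩV k n) (η : W k (n + 1) → Fin 2) :
    bdryWeight lam σ η = lam ^ numOcc σ.1 * if Compatible σ.1 η then 1 else 0 := by
  have h : Admissible (V k (n + 1) : Set (G k)) (join σ.1 η) ↔ Compatible σ.1 η := by
    constructor
    · rintro h x y hxy ⟨hx, hy⟩
      refine h ⟨x, V_mono n.le_succ x.2⟩ ⟨y, W_subset_V k (n + 1) y.2⟩ hxy ⟨?_, ?_⟩
      · rw [join_apply_V, hx]
      · rw [join_apply_W, hy]
    · rintro h ⟨x, hx⟩ ⟨y, hy⟩ hxy ⟨h1, h2⟩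
      simp only at hxy
      simp only [join] at h1 h2
      split_ifs at h1 h2 with hxV hyV hyV
      · exact σ.2 ⟨x, hxV⟩ ⟨y, hyV⟩ hxy ⟨h1, h2⟩
      · exact h ⟨x, hxV⟩ _ hxy ⟨h1, h2⟩
      · exact h ⟨y, hyV⟩ _ hxy.symm ⟨h2, h1⟩
      -- Two vertices of one sphere have equal parity, so they are never adjacent.
      · have e1 := mem_W.1 (mem_W_succ_of_not_mem_V hx hxV)
        have e2 := mem_W.1 (mem_W_succ_of_not_mem_V hy hyV)
        have := even_len_iff_of_adj hxy
        rw [e1, e2] at this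
        tauto
  rw [bdryWeight, if_congr h rfl rfl]
  split_ifs <;> simp

open Classical in
/-- Among all boundary conditions, the vacant one maximises the conditional probability of
agreeing with `p` on `S`, provided that `p` is occupied on the sphere `W_n`. -/
theorem sum_condProb_le {lam : ℝ} (hlam : 0 ≤ lam) {p : G k → Fin 2} (hp : IsChessboard p)
    (hpn : ∀ x, len x = n → p x = 1) (S : Finset (G k)) (η : W k (n + 1) → Fin 2) :
    ∑ σ : ΩV k n with AgreesOn p S σ, condProb lam σ η ≤
      ∑ σ : ΩV k n with AgreesOn p S σ, zProb lam (fun _ => 1) σ := by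
  -- `f` indicates agreement on `S`, `g` incompatibility with η. Both increase with the agreement
  -- set, so conditioning on compatibility can only lower the probability of `f`.
  let f : Finset (V k n) → ℝ := fun s => if ∀ x : V k n, (x : G k) ∈ S → x ∈ s then 1 else 0
  let g : Finset (V k n) → ℝ := fun s => if Compatible (agreeConf p s) η then 0 else 1
  have hf0 : 0 ≤ f := fun s => by
    change (0 : ℝ) ≤ if _ then 1 else 0
    split_ifs <;> norm_num
  have hg0 : 0 ≤ g := fun s => by
    change (0 : ℝ) ≤ if _ then 0 else 1
    split_ifs <;> norm_num
  have hf : Monotone f := by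
    intro s t hst
    by_cases hs : ∀ x : V k n, (x : G k) ∈ S → x ∈ s
    · have ht : ∀ x : V k n, (x : G k) ∈ S → x ∈ t := fun x hx => hst (hs x hx)
      exact ((if_pos hs).trans (if_pos ht).symm).le
    · have : f s = 0 := if_neg hs
      rw [this]
      exact hf0 t
  -- Only vertices of W_n touch W_{n+1}, and there `p` is occupied: more agreement means more
  -- occupied vertices and more conflicts with η.
  have hg : Monotone g := by
    intro s t hst
    by_cases ht : Compatible (agreeConf p t) η
    · have hs : Compatible (agreeConf p s) η := by
        rintro x y hxy ⟨hx, hy⟩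
        have hpx : p x = 1 := by
          refine hpn _ ?_
          have h1 := mem_V.1 x.2
          have h2 := mem_W.1 y.2
          rcases adj_iff_parent.1 hxy with ⟨h3, h4⟩ | ⟨h3, h4⟩
          · have := len_parent h3
            rw [h4] at this
            omega
          · have := len_parent h3
            rw [h4] at this
            omega
        refine ht x y hxy ⟨?_, hy⟩
        rw [agreeConf_eq_one_iff_of_one hpx] at *
        exact hst hx
      simp [g, hs, ht]
    · have : g t = 1 := if_neg ht
      rw [this]
      change (if _ then (0 : ℝ) else 1) ≤ 1
      split_ifs <;> norm_num
  have hfkg := fkg (μ := agreeWeight lam p) (f := f) (g := g)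
    (hμ₀ := fun s => agreeWeight_nonneg hlam p s) (hf₀ := hf0) (hg₀ := hg0) (hf := hf) (hg := hg)
    (hμ := agreeWeight_mul_le hlam hp)
  set P : (V k n → Fin 2) → Prop := fun σ => ∀ x : V k n, (x : G k) ∈ S → σ x = p x with hP
  have hPf : ∀ s : Finset (V k n), f s = if P (agreeConf p s) then 1 else 0 := by
    intro s
    refine if_congr (forall₂_congr fun x _ => ?_) rfl rfl
    by_cases h : x ∈ s
    · simp [agreeConf, h]
    · simp only [agreeConf, h, if_false, false_iff]
      omega
  set wt : ΩV k n → ℝ := fun σ => lam ^ numOcc σ.1 with hwt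
  have e1 : ∑ s, agreeWeight lam p s * f s = ∑ σ : ΩV k n, wt σ * if P σ.1 then 1 else 0 := by
    rw [sum_agreeConf lam p fun σ => if P σ then 1 else 0]
    simp_rw [hPf]
  have e2 : ∑ s, agreeWeight lam p s * g s =
      ∑ σ : ΩV k n, wt σ * if Compatible σ.1 η then 0 else 1 :=
    (sum_agreeConf lam p fun σ => if Compatible σ η then 0 else 1).symm
  have e3 : ∑ s : Finset (V k n), agreeWeight lam p s = ∑ σ : ΩV k n, wt σ := by
    have := sum_agreeConf (n := n) lam p fun _ => 1
    simpa using this.symm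
  have e4 : ∑ s, agreeWeight lam p s * (f s * g s) =
      ∑ σ : ΩV k n, wt σ * ((if P σ.1 then 1 else 0) * if Compatible σ.1 η then 0 else 1) := by
    rw [sum_agreeConf lam p fun σ => (if P σ then 1 else 0) * if Compatible σ η then 0 else 1]
    simp_rw [hPf]
    rfl
  rw [e1, e2, e3, e4] at hfkg
  have hcompl : ∀ σ : ΩV k n, wt σ * (if Compatible σ.1 η then (0 : ℝ) else 1) =
      wt σ - bdryWeight lam σ η := by
    intro σ
    rw [bdryWeight_eq]
    split_ifs <;> simp [hwt]
  have hcompl' : ∀ σ : ΩV k n, wt σ * ((if P σ.1 then 1 else 0) *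
      if Compatible σ.1 η then (0 : ℝ) else 1) =
      wt σ * (if P σ.1 then 1 else 0) - bdryWeight lam σ η * (if P σ.1 then 1 else 0) := by
    intro σ
    rw [bdryWeight_eq]
    split_ifs <;> simp [hwt]
  simp_rw [hcompl, hcompl', Finset.sum_sub_distrib] at hfkg
  have hz : ∀ σ : ΩV k n, zWeight lam (fun _ => 1) σ = wt σ := by
    intro σ
    simp [zWeight, hwt]
  have e5 : ∀ u : ΩV k n → ℝ, ∑ σ : ΩV k n with AgreesOn p S σ, u σ =
      ∑ σ : ΩV k n, u σ * if P σ.1 then 1 else 0 := by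
    intro u
    rw [Finset.sum_filter]
    refine Finset.sum_congr rfl fun σ _ => ?_
    rw [mul_ite, mul_one, mul_zero]
    exact if_congr Iff.rfl rfl rfl
  have hpos : 0 < ∑ σ : ΩV k n, wt σ := by
    have := sum_zWeight_pos hlam (z := fun _ : G k => (1 : ℝ)) (fun _ => zero_le_one) n
    simpa only [hz] using this
  simp only [condProb, zProb, hz]
  rw [← Finset.sum_div, ← Finset.sum_div, e5, e5]
  have hb : 0 ≤ ∑ σ : ΩV k n, bdryWeight lam σ η :=
    Finset.sum_nonneg fun σ _ => bdryWeight_nonneg hlam σ η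
  rcases hb.eq_or_lt with hb | hb
  -- With a zero denominator `condProb` is zero by convention and the bound is trivial.
  · rw [← hb, div_zero]
    refine div_nonneg (Finset.sum_nonneg fun σ _ => mul_nonneg (pow_nonneg hlam _) ?_) hpos.le
    split_ifs <;> norm_num
  · rw [div_le_div_iff₀ hb hpos]
    linarith

end Comparison

open MeasureTheory Filter Topology

/-! ## The scalar recursion -/

section Scalar

/-- The scalar recursion for collections that are constant on spheres. -/
noncomputable def scalarStep (k : ℕ) (lam z : ℝ) : ℝ := ((1 + lam * z)⁻¹) ^ k

variable {lam : ℝ}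

lemma scalarStep_nonneg {k : ℕ} (hlam : 0 ≤ lam) {z : ℝ} (hz : 0 ≤ z) :
    0 ≤ scalarStep k lam z := by
  unfold scalarStep
  have := mul_nonneg hlam hz
  positivity

lemma scalarStep_pos {k : ℕ} (hlam : 0 ≤ lam) {z : ℝ} (hz : 0 ≤ z) :
    0 < scalarStep k lam z := by
  unfold scalarStep
  have := mul_nonneg hlam hz
  positivity

lemma scalarStep_le_one {k : ℕ} (hlam : 0 ≤ lam) {z : ℝ} (hz : 0 ≤ z) :
    scalarStep k lam z ≤ 1 := by
  have := mul_nonneg hlam hz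
  exact pow_le_one₀ (by positivity) (inv_le_one_of_one_le₀ (by linarith))

lemma scalarStep_anti {k : ℕ} (hlam : 0 ≤ lam) {z w : ℝ} (hz : 0 ≤ z) (hzw : z ≤ w) :
    scalarStep k lam w ≤ scalarStep k lam z := by
  have h1 := mul_nonneg hlam hz
  have h2 := mul_le_mul_of_nonneg_left hzw hlam
  unfold scalarStep
  exact pow_le_pow_left₀ (inv_nonneg.2 (by linarith)) (inv_anti₀ (by linarith) (by linarith)) k

lemma tendsto_scalarStep {k : ℕ} (hlam : 0 ≤ lam) {u : ℕ → ℝ} {z : ℝ} (hz : 0 ≤ z)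
    (hu : Tendsto u atTop (𝓝 z)) :
    Tendsto (fun j => scalarStep k lam (u j)) atTop (𝓝 (scalarStep k lam z)) := by
  have := mul_nonneg hlam hz
  exact (((hu.const_mul lam).const_add 1).inv₀ (by positivity)).pow k

/-- The two-cycles of the scalar recursion for `k = 2`. -/
lemma scalarStep_two_cycle (hlam : 0 < lam) {a b : ℝ} (ha : 0 < a) (hb : 0 < b) (hab : a ≠ b)
    (h1 : a = scalarStep 2 lam b) (h2 : b = scalarStep 2 lam a) :
    ∃ u v : ℝ, 0 < u ∧ 0 < v ∧ a = u ^ 2 ∧ b = v ^ 2 ∧ u + v = 1 ∧ lam * (u * v) = 1 := by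
  have hpa : 0 < 1 + lam * a := by positivity
  have hpb : 0 < 1 + lam * b := by positivity
  -- These are the positive square roots of a and b.
  refine ⟨(1 + lam * b)⁻¹, (1 + lam * a)⁻¹, inv_pos.2 hpb, inv_pos.2 hpa, h1, h2, ?_⟩
  set u := (1 + lam * b)⁻¹ with hu
  set v := (1 + lam * a)⁻¹ with hv
  have ha' : a = u ^ 2 := h1
  have hb' : b = v ^ 2 := h2
  have e1 : u * (1 + lam * v ^ 2) = 1 := by
    rw [← hb', hu, inv_mul_cancel₀ hpb.ne']
  have e2 : v * (1 + lam * u ^ 2) = 1 := by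
    rw [← ha', hv, inv_mul_cancel₀ hpa.ne']
  have huv : u - v ≠ 0 := fun h => hab (by rw [ha', hb', sub_eq_zero.1 h])
  have e3 : lam * (u * v) = 1 := by
    have : (u - v) * (1 - lam * (u * v)) = 0 := by linear_combination e1 - e2
    rcases mul_eq_zero.1 this with h | h
    · exact absurd h huv
    · linarith
  refine ⟨?_, e3⟩
  linear_combination e1 - v * e3

variable (lam) in
/-- The larger root of `λ t (1 - t) = 1`. -/
noncomputable def rootPlus : ℝ := (lam + √(lam ^ 2 - 4 * lam)) / (2 * lam)

variable (lam) in
/-- The smaller root of `λ t (1 - t) = 1`. -/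
noncomputable def rootMinus : ℝ := (lam - √(lam ^ 2 - 4 * lam)) / (2 * lam)

lemma root_add (hlam : 4 < lam) : rootPlus lam + rootMinus lam = 1 := by
  unfold rootPlus rootMinus
  field_simp
  ring

lemma root_mul (hlam : 4 < lam) : lam * (rootPlus lam * rootMinus lam) = 1 := by
  have h := Real.sq_sqrt (show 0 ≤ lam ^ 2 - 4 * lam by nlinarith)
  have h0 : lam ≠ 0 := by linarith
  have h1 : rootPlus lam * rootMinus lam =
      (lam ^ 2 - √(lam ^ 2 - 4 * lam) ^ 2) / (4 * lam ^ 2) := by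
    unfold rootPlus rootMinus
    generalize √(lam ^ 2 - 4 * lam) = D
    field_simp
    ring
  rw [h1, h]
  field_simp
  ring

lemma rootMinus_lt_rootPlus (hlam : 4 < lam) : rootMinus lam < rootPlus lam := by
  have h : 0 < √(lam ^ 2 - 4 * lam) := Real.sqrt_pos.2 (by nlinarith)
  unfold rootPlus rootMinus
  gcongr
  linarith

lemma rootPlus_pos (hlam : 4 < lam) : 0 < rootPlus lam := by
  have h1 := root_add hlam
  have h2 := rootMinus_lt_rootPlus hlam
  linarith

lemma rootMinus_pos (hlam : 4 < lam) : 0 < rootMinus lam := by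
  have h1 := root_mul hlam
  have h2 := rootPlus_pos hlam
  by_contra h
  have := mul_nonpos_of_nonneg_of_nonpos (show 0 ≤ lam by linarith)
    (mul_nonpos_of_nonneg_of_nonpos h2.le (not_lt.1 h))
  linarith

lemma eq_roots {u v : ℝ} (hlam : 4 < lam) (h1 : u + v = 1) (h2 : lam * (u * v) = 1) :
    (u = rootPlus lam ∧ v = rootMinus lam) ∨ (u = rootMinus lam ∧ v = rootPlus lam) := by
  have e1 := root_add hlam
  have e2 := root_mul hlam
  have hlam0 : lam ≠ 0 := by linarith
  have e3 : u * v = rootPlus lam * rootMinus lam := mul_left_cancel₀ hlam0 (h2.trans e2.symm)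
  have : (u - rootPlus lam) * (u - rootMinus lam) = 0 := by
    linear_combination u * h1 - u * e1 - e3
  rcases mul_eq_zero.1 this with h | h
  · exact Or.inl ⟨by linarith, by linarith⟩
  · exact Or.inr ⟨by linarith, by linarith⟩

lemma scalarStep_root {u v : ℝ} (h1 : u + v = 1) (h2 : lam * (u * v) = 1) :
    scalarStep 2 lam (v ^ 2) = u ^ 2 := by
  have h3 : u * (1 + lam * v ^ 2) = 1 := by linear_combination h1 + v * h2
  rw [scalarStep, eq_inv_of_mul_eq_one_left h3]

lemma scalarStep_rootMinus (hlam : 4 < lam) :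
    scalarStep 2 lam (rootMinus lam ^ 2) = rootPlus lam ^ 2 :=
  scalarStep_root (root_add hlam) (root_mul hlam)

lemma scalarStep_rootPlus (hlam : 4 < lam) :
    scalarStep 2 lam (rootPlus lam ^ 2) = rootMinus lam ^ 2 :=
  scalarStep_root (by rw [add_comm, root_add hlam])
    (by rw [mul_comm (rootMinus lam), root_mul hlam])

lemma sq_root_lt (hlam : 4 < lam) : rootMinus lam ^ 2 < rootPlus lam ^ 2 :=
  pow_lt_pow_left₀ (rootMinus_lt_rootPlus hlam) (rootMinus_pos hlam).le two_ne_zero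

/-- The even iterates started at `1` converge to the larger point of the two-cycle. -/
lemma tendsto_iterate_scalarStep (hlam : 4 < lam) :
    Tendsto (fun j => (scalarStep 2 lam)^[2 * j] 1) atTop (𝓝 (rootPlus lam ^ 2)) := by
  have hl : 0 ≤ lam := by linarith
  set F := scalarStep 2 lam with hF
  set a := rootPlus lam ^ 2 with ha
  have ha0 : 0 < a := pow_pos (rootPlus_pos hlam) 2
  have hFFa : F (F a) = a := by
    rw [hF, ha, scalarStep_rootPlus hlam, scalarStep_rootMinus hlam]
  set u : ℕ → ℝ := fun j => F^[2 * j] 1 with hu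
  have hus : ∀ j, u (j + 1) = F (F (u j)) := by
    intro j
    simp only [hu]
    rw [show 2 * (j + 1) = 2 * j + 1 + 1 by ring, Function.iterate_succ_apply',
      Function.iterate_succ_apply']
  have hFF : ∀ x y, 0 ≤ x → x ≤ y → F (F x) ≤ F (F y) := fun x y hx hxy =>
    scalarStep_anti hl (scalarStep_nonneg hl (hx.trans hxy)) (scalarStep_anti hl hx hxy)
  have hau : ∀ j, a ≤ u j := by
    intro j
    induction j with
    | zero =>
      change a ≤ 1
      rw [← hFFa]
      exact scalarStep_le_one hl (scalarStep_nonneg hl ha0.le)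
    | succ j ih =>
      rw [hus, ← hFFa]
      exact hFF _ _ ha0.le ih
  have hanti : Antitone u := by
    refine antitone_nat_of_succ_le fun j => ?_
    induction j with
    | zero =>
      rw [hus]
      exact scalarStep_le_one hl (scalarStep_nonneg hl zero_le_one)
    | succ j ih =>
      rw [hus (j + 1)]
      nth_rewrite 2 [hus j]
      exact hFF _ _ (ha0.le.trans (hau _)) ih
  obtain ⟨L, hL⟩ : ∃ L, Tendsto u atTop (𝓝 L) :=
    ⟨_, tendsto_atTop_ciInf hanti ⟨a, by rintro _ ⟨j, rfl⟩; exact hau j⟩⟩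
  have haL : a ≤ L := ge_of_tendsto' hL hau
  have hL0 : 0 < L := ha0.trans_le haL
  have hFFL : F (F L) = L := by
    refine tendsto_nhds_unique ?_ ((tendsto_add_atTop_iff_nat 1).2 hL)
    simp_rw [hus]
    exact tendsto_scalarStep hl (scalarStep_nonneg hl hL0.le) (tendsto_scalarStep hl hL0.le hL)
  have hlt := sq_root_lt hlam
  -- The limit is no fixed point of F: L ≥ a forces F(L) ≤ F(a), the smaller cycle point, which lies
  -- below a ≤ L. So L lies on a genuine two-cycle, and being at least a it equals a.
  have hne : L ≠ F L := by
    intro h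
    have h1 : F L ≤ F a := scalarStep_anti hl ha0.le haL
    rw [← h, hF, ha, scalarStep_rootPlus hlam] at h1
    linarith
  obtain ⟨s, t, hs, ht, hLs, -, hst, hst'⟩ := scalarStep_two_cycle (by linarith) hL0
    (scalarStep_pos hl hL0.le) hne hFFL.symm rfl
  have hLa : L = a := by
    rcases eq_roots hlam hst hst' with h | h
    · rw [hLs, h.1]
    · rw [hLs, h.1] at haL
      linarith
  rwa [hLa] at hL

end Scalar

/-! ## Extremality -/

section Extreme

variable {k : ℕ}

lemma prod_children_of_const {lam c : ℝ} {z : G k → ℝ} {x : G k} (hx : x ≠ 1)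
    (h : ∀ y ∈ children x, z y = c) :
    ∏ y ∈ children x, (1 + lam * z y)⁻¹ = scalarStep k lam c := by
  rw [Finset.prod_congr rfl fun y hy => by rw [h y hy], Finset.prod_const, card_children hx]
  rfl

lemma iterate_recStep_const {lam c : ℝ} (i : ℕ) {x : G k} (hx : x ≠ 1) :
    (recStep lam)^[i] (fun _ => c) x = (scalarStep k lam)^[i] c := by
  induction i generalizing x with
  | zero => rfl
  | succ i ih =>
    rw [Function.iterate_succ_apply', Function.iterate_succ_apply', recStep]
    exact prod_children_of_const hx fun y hy => ih (mem_children.1 hy).1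

-- DLR averages the comparison bound over the boundary on W_{m+i+1}. The resulting vacant-boundary
-- law has z = 1 on W_{m+i}, and each level integrated out applies `scalarStep` once.
open Classical in
lemma gibbs_real_agreeEvent_le {lam : ℝ} (hlam : 0 ≤ lam) {ν : Measure (Ω k)}
    (hν : ν ∈ gibbsMeasures k lam) {p : G k → Fin 2} (hp : IsChessboard p) {m : ℕ} (hm : 1 ≤ m)
    {S : Finset (G k)} (hS : S ⊆ V k m) (i : ℕ) (hpn : ∀ x, len x = m + i → p x = 1) :
    ν.real (agreeEvent p S) ≤
      ∑ σ : ΩV k m with AgreesOn p S σ,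
        zProb lam (fun _ => (scalarStep k lam)^[i] 1) σ := by
  have := hν.1
  have h1 : ν.real (agreeEvent p S) ≤
      ∑ σ : ΩV k (m + i) with AgreesOn p S σ,
        zProb lam (fun _ => 1) σ := by
    rw [agreeEvent_eq_resV p (hS.trans (V_mono (Nat.le_add_right m i))),
      real_resV_mem ν (m + i) (AgreesOn _ S)]
    have h2 : ∀ σ : ΩV k (m + i), ν.real {ω | restr (V k (m + i)) ω = σ.1} =
        ∑ τ : ΩV k (m + i + 1), condProb lam σ (outer τ.1) *
          ν.real {ω | restr (V k (m + i + 1)) ω = τ.1} := fun σ =>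
      (hν.2 (m + i) σ).trans (integral_resV (n := m + i + 1) fun τ => condProb lam σ (outer τ.1))
    rw [Finset.sum_congr rfl fun σ _ => h2 σ, Finset.sum_comm]
    simp_rw [← Finset.sum_mul]
    refine (Finset.sum_le_sum fun τ _ => mul_le_mul_of_nonneg_right
      (sum_condProb_le hlam hp hpn S (outer τ.1)) measureReal_nonneg).trans ?_
    rw [← Finset.mul_sum, sum_real_cylinder, mul_one]
  refine h1.trans (le_of_eq ?_)
  have hz : ∀ _ : G k, (0 : ℝ) ≤ 1 := fun _ => zero_le_one
  set M := chainMeasure lam (backward lam (fun _ : G k => (1 : ℝ)) (m + i)) with hM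
  have h3 : M.real (agreeEvent p S) =
      ∑ σ : ΩV k (m + i) with AgreesOn p S σ,
        zProb lam (fun _ => 1) σ := by
    rw [agreeEvent_eq_resV p (hS.trans (V_mono (Nat.le_add_right m i))),
      real_resV_mem M (m + i) (AgreesOn _ S)]
    exact Finset.sum_congr rfl fun σ _ => chainMeasure_backward_top hlam hz σ
  rw [← h3, agreeEvent_eq_resV p hS,
    real_resV_mem M m (AgreesOn _ S)]
  refine Finset.sum_congr rfl fun σ _ => ?_
  rw [hM, chainMeasure_backward hlam hz (Nat.le_add_right m i)]
  refine zProb_congr (fun x hx => ?_) σ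
  rw [backward, hx, Nat.add_sub_cancel_left, iterate_recStep_const]
  rintro rfl
  rw [len_one] at hx
  omega

lemma tendsto_zProb_const {lam : ℝ} (hlam : 0 ≤ lam) {u : ℕ → ℝ} {a : ℝ} (ha : 0 ≤ a)
    (hu : Tendsto u atTop (𝓝 a)) {n : ℕ} (σ : ΩV k n) :
    Tendsto (fun j => zProb lam (fun _ => u j) σ) atTop (𝓝 (zProb lam (fun _ => a) σ)) := by
  have h : ∀ σ : ΩV k n,
      Tendsto (fun j => zWeight lam (fun _ => u j) σ) atTop (𝓝 (zWeight lam (fun _ => a) σ)) := by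
    intro σ
    refine Tendsto.const_mul _ (tendsto_finsetProd _ fun x _ => ?_)
    split_ifs
    · exact hu
    · exact tendsto_const_nhds
  exact (h σ).div (tendsto_finsetSum _ fun τ _ => h τ)
    (sum_zWeight_pos hlam (fun _ => ha) n).ne'

/-- The configuration occupied exactly on the vertices `x` with `|x| + e` even. -/
noncomputable def board (k e : ℕ) (x : G k) : Fin 2 := by
  classical
  exact if Even (len x + e) then 1 else 0

lemma board_eq_one_iff {e : ℕ} {x : G k} : board k e x = 1 ↔ Even (len x + e) := by
  by_cases h : Even (len x + e) <;> simp [board, h]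

lemma isChessboard_board (e : ℕ) : IsChessboard (board k e) := by
  intro x y hxy h
  have h1 := even_len_iff_of_adj hxy
  have h2 : Even (len x + e) ↔ Even (len y + e) := by
    rw [← board_eq_one_iff, ← board_eq_one_iff, h]
  rw [Nat.even_add, Nat.even_add] at h2
  tauto

/-- Every Gibbs measure is dominated, on the events of agreement with a chessboard configuration,
by the measure built from the limit of the even iterates. -/
lemma gibbs_real_agreeEvent_le_corresponds {lam a : ℝ} (hlam : 0 ≤ lam) (ha : 0 ≤ a)
    (hlim : Tendsto (fun j => (scalarStep k lam)^[2 * j] 1) atTop (𝓝 a)) {e : ℕ}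
    {z : G k → ℝ} (hz : ∀ x, Even (len x + e) → z x = a) {μ ν : Measure (Ω k)}
    (hμ : Corresponds lam z μ) (hν : ν ∈ gibbsMeasures k lam) (S : Finset (G k)) :
    ν.real (agreeEvent (board k e) S) ≤ μ.real (agreeEvent (board k e) S) := by
  classical
  have := hμ.2.1
  obtain ⟨n, hn⟩ := exists_subset_V S
  -- V_m contains `S`, m ≥ 1, and m + e is even, so the board is occupied on the spheres m + 2j and
  -- z = a on W_m.
  set m := 2 * n + e + 2 with hm
  have hme : Even (m + e) := ⟨n + e + 1, by omega⟩
  have hS : S ⊆ V k m := hn.trans (V_mono (by omega))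
  have h1 : μ.real (agreeEvent (board k e) S) =
      ∑ σ : ΩV k m with AgreesOn (board k e) S σ,
        zProb lam (fun _ => a) σ := by
    rw [agreeEvent_eq_resV _ hS,
      real_resV_mem μ m (AgreesOn _ S)]
    refine Finset.sum_congr rfl fun σ _ => ?_
    rw [hμ.2.2 m (by omega)]
    exact zProb_congr (fun x hx => hz x (by rw [hx]; exact hme)) σ
  rw [h1]
  refine ge_of_tendsto' (tendsto_finsetSum _ fun σ _ => tendsto_zProb_const hlam ha hlim σ)
    fun j => ?_
  refine gibbs_real_agreeEvent_le hlam hν (isChessboard_board e) (by omega) hS (2 * j) ?_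
  intro x hx
  rw [board_eq_one_iff, hx, add_right_comm]
  exact hme.add (even_two_mul j)

/-- If a mixture attains a maximum, so does each component with positive coefficient. Here this
holds for every agreement event, and these determine the measure. Scalars are `ℝ≥0` because measures
are a module over them. -/
lemma mem_extremePoints_of_dominates {lam : ℝ} {p : G k → Fin 2} {μ : Measure (Ω k)}
    (hμ : μ ∈ gibbsMeasures k lam)
    (h : ∀ ν ∈ gibbsMeasures k lam, ∀ S, ν.real (agreeEvent p S) ≤ μ.real (agreeEvent p S)) :
    μ ∈ Set.extremePoints ℝ≥0 (gibbsMeasures k lam) := by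
  refine ⟨hμ, ?_⟩
  rintro ν hν ν' hν' ⟨a, b, ha, hb, hab, hsum⟩
  have := hμ.1
  have := hν.1
  have := hν'.1
  refine ext_of_agreeEvent p fun S => le_antisymm (h ν hν S) ?_
  have h1 : μ.real (agreeEvent p S) =
      a * ν.real (agreeEvent p S) + b * ν'.real (agreeEvent p S) := by
    conv_lhs => rw [← hsum]
    rw [measureReal_add_apply, measureReal_nnreal_smul_apply, measureReal_nnreal_smul_apply]
  have h2 := h ν' hν' S
  have hab' : (a : ℝ) + b = 1 := by exact_mod_cast hab
  have ha' : (0 : ℝ) < a := ha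
  have hb' : (0 : ℝ) ≤ b := b.2
  have h3 := mul_le_mul_of_nonneg_left h2 hb'
  have h4 : (a : ℝ) * μ.real (agreeEvent p S) ≤ a * ν.real (agreeEvent p S) := by
    have : μ.real (agreeEvent p S) =
      a * μ.real (agreeEvent p S) + b * μ.real (agreeEvent p S) := by
      rw [← add_mul, hab', one_mul]
    linarith
  exact le_of_mul_le_mul_left h4 ha'

end Extreme

/-! ## Periodic measures -/

section Periodic

variable {k : ℕ}

lemma alternating_of_even {a b : ℝ} {x : G k} (h : Even (len x)) : alternating k a b x = a :=
  if_pos h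

lemma alternating_of_odd {a b : ℝ} {x : G k} (h : ¬ Even (len x)) : alternating k a b x = b :=
  if_neg h

lemma alternating_pos {a b : ℝ} (ha : 0 < a) (hb : 0 < b) (x : G k) :
    0 < alternating k a b x := by
  by_cases h : Even (len x)
  · rwa [alternating_of_even h]
  · rwa [alternating_of_odd h]

lemma isPeriodic_alternating (a b : ℝ) : IsPeriodic (evenSubgroup k) (alternating k a b) := by
  intro x y hy
  have : y * x ∈ evenSubgroup k ↔ x ∈ evenSubgroup k := Subgroup.mul_mem_cancel_left _ hy
  by_cases h : x ∈ evenSubgroup k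
  · rw [alternating_of_even h, alternating_of_even (this.2 h)]
  · rw [alternating_of_odd h, alternating_of_odd (mt this.1 h)]

/-- The even subgroup has two cosets: an odd x is (x a₁) a₁ with x a₁ even (a₁ is `gen k 0`). -/
lemma exists_eq_alternating {z : G k → ℝ} (hz : IsPeriodic (evenSubgroup k) z) :
    ∃ a b, z = alternating k a b := by
  refine ⟨z 1, z (gen k 0), funext fun x => ?_⟩
  by_cases h : Even (len x)
  · rw [alternating_of_even h]
    simpa using hz 1 x h
  · rw [alternating_of_odd h]
    have h1 : Even (len (x * gen k 0)) := by
      have := even_len_iff_of_adj (tree_adj.2 ⟨0, rfl⟩ : (tree k).Adj x (x * gen k 0))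
      tauto
    have := hz (gen k 0) (x * gen k 0) h1
    rwa [mul_gen_mul_gen] at this

lemma prod_children_alternating {lam a b : ℝ} {x : G k} (hx : x ≠ 1) :
    ∏ y ∈ children x, (1 + lam * alternating k a b y)⁻¹ =
      alternating k (scalarStep k lam b) (scalarStep k lam a) x := by
  by_cases h : Even (len x)
  · rw [alternating_of_even h]
    refine prod_children_of_const hx fun y hy => alternating_of_odd ?_
    rw [len_of_mem_children hy, Nat.even_add_one, not_not]
    exact h
  · rw [alternating_of_odd h]
    refine prod_children_of_const hx fun y hy => alternating_of_even ?_
    rw [len_of_mem_children hy, Nat.even_add_one]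
    exact h

lemma exists_ne_one_even_odd (hk : 1 ≤ k) :
    ∃ x y : G k, x ≠ 1 ∧ y ≠ 1 ∧ Even (len x) ∧ ¬ Even (len y) := by
  obtain ⟨x, hx⟩ := exists_len_eq hk 2
  obtain ⟨y, hy⟩ := exists_len_eq hk 1
  refine ⟨x, y, ?_, ?_, by rw [hx]; decide, by rw [hy]; decide⟩
  · rintro rfl
    rw [len_one] at hx
    omega
  · rintro rfl
    rw [len_one] at hy
    omega

lemma alternating_inj_of_ne_one (hk : 1 ≤ k) {a b a' b' : ℝ}
    (h : ∀ x : G k, x ≠ 1 → alternating k a b x = alternating k a' b' x) : a = a' ∧ b = b' := by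
  obtain ⟨x, y, hx, hy, hxe, hyo⟩ := exists_ne_one_even_odd hk
  have h1 := h x hx
  have h2 := h y hy
  rw [alternating_of_even hxe, alternating_of_even hxe] at h1
  rw [alternating_of_odd hyo, alternating_of_odd hyo] at h2
  exact ⟨h1, h2⟩

lemma isTranslationInvariantGibbs_iff_of_corresponds (hk : 1 ≤ k) {lam a b : ℝ} (hlam : 0 < lam)
    {μ : Measure (Ω k)} (h : Corresponds lam (alternating k a b) μ) :
    IsTranslationInvariantGibbs lam μ ↔ a = b := by
  constructor
  · rintro ⟨z, hz, hzμ⟩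
    have hz1 : z = alternating k (z 1) (z 1) := by
      funext x
      have : z x = z 1 := by simpa using hz 1 x trivial
      rw [this, alternating, ite_self]
    rw [hz1] at hzμ
    have := alternating_inj_of_ne_one hk fun x hx => h.eq_of_ne_one hlam hzμ hx
    exact this.1.trans this.2.symm
  · rintro rfl
    refine ⟨_, fun x y _ => ?_, h⟩
    rw [alternating, alternating, ite_self, ite_self]

end Periodic

end HardCore

theorem mainTheorem1 (lam z₁ z₂ : ℝ) (hlam : 4 < lam)
    (hz₁ : z₁ = ((lam + √(lam ^ 2 - 4 * lam)) / (2 * lam)) ^ 2)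
    (hz₂ : z₂ = ((lam - √(lam ^ 2 - 4 * lam)) / (2 * lam)) ^ 2) :
    ∃ μ₁ μ₂ : MeasureTheory.Measure (HardCore.Ω 2),
      μ₁ ≠ μ₂ ∧
      {μ | HardCore.IsPeriodicGibbs lam (HardCore.evenSubgroup 2) μ ∧
        ¬ HardCore.IsTranslationInvariantGibbs lam μ} = {μ₁, μ₂} ∧
      HardCore.Corresponds lam (HardCore.alternating 2 z₁ z₂) μ₁ ∧
      HardCore.Corresponds lam (HardCore.alternating 2 z₂ z₁) μ₂ ∧
      μ₁ ∈ Set.extremePoints ℝ≥0 (HardCore.gibbsMeasures 2 lam) ∧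
      μ₂ ∈ Set.extremePoints ℝ≥0 (HardCore.gibbsMeasures 2 lam) := by
  open HardCore in
  have hz₁' : z₁ = rootPlus lam ^ 2 := hz₁
  have hz₂' : z₂ = rootMinus lam ^ 2 := hz₂
  have hl : 0 < lam := by linarith
  have hp₁ : 0 < z₁ := hz₁' ▸ pow_pos (rootPlus_pos hlam) 2
  have hp₂ : 0 < z₂ := hz₂' ▸ pow_pos (rootMinus_pos hlam) 2
  have hs₁ : scalarStep 2 lam z₁ = z₂ := by rw [hz₁', hz₂', scalarStep_rootPlus hlam]
  have hs₂ : scalarStep 2 lam z₂ = z₁ := by rw [hz₁', hz₂', scalarStep_rootMinus hlam]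
  have hne : z₁ ≠ z₂ := by
    rw [hz₁', hz₂']
    exact (sq_root_lt hlam).ne'
  have hlim := tendsto_iterate_scalarStep hlam
  rw [← hz₁'] at hlim
  obtain ⟨μ₁, hμ₁⟩ := corresponds_chainMeasure hl (alternating_pos (k := 2) hp₁ hp₂)
    fun x hx => by rw [prod_children_alternating hx, hs₁, hs₂]
  obtain ⟨μ₂, hμ₂⟩ := corresponds_chainMeasure hl (alternating_pos (k := 2) hp₂ hp₁)
    fun x hx => by rw [prod_children_alternating hx, hs₁, hs₂]
  refine ⟨μ₁, μ₂, ?_, ?_, hμ₁, hμ₂, ?_, ?_⟩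
  · rintro rfl
    exact hne (alternating_inj_of_ne_one one_le_two fun x hx => hμ₁.eq_of_ne_one hl hμ₂ hx).1
  · ext μ
    rw [Set.mem_ofPred_eq, Set.mem_insert_iff, Set.mem_singleton_iff]
    constructor
    · rintro ⟨⟨z, hz, hμ⟩, hnti⟩
      obtain ⟨a, b, rfl⟩ := exists_eq_alternating hz
      rw [isTranslationInvariantGibbs_iff_of_corresponds one_le_two hl hμ] at hnti
      obtain ⟨x, y, -, -, hxe, hyo⟩ := exists_ne_one_even_odd (k := 2) one_le_two
      have ha : 0 < a := alternating_of_even (a := a) (b := b) hxe ▸ hμ.1 x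
      have hb : 0 < b := alternating_of_odd (a := a) (b := b) hyo ▸ hμ.1 y
      -- The recursion swaps the sublattices, so one even and one odd vertex off the root yield the
      -- two-cycle equations.
      obtain ⟨hab, hba⟩ := alternating_inj_of_ne_one one_le_two fun x hx =>
        (hμ.recursion hl hx).trans (prod_children_alternating hx)
      obtain ⟨u, v, -, -, hu, hv, h1, h2⟩ := scalarStep_two_cycle hl ha hb hnti hab hba
      rcases eq_roots hlam h1 h2 with ⟨rfl, rfl⟩ | ⟨rfl, rfl⟩
      · rw [← hz₁'] at hu
        rw [← hz₂'] at hv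
        subst hu hv
        exact Or.inl (hμ.measure_eq hμ₁ fun _ _ => rfl)
      · rw [← hz₂'] at hu
        rw [← hz₁'] at hv
        subst hu hv
        exact Or.inr (hμ.measure_eq hμ₂ fun _ _ => rfl)
    · rintro (rfl | rfl)
      · refine ⟨⟨_, isPeriodic_alternating _ _, hμ₁⟩, ?_⟩
        rwa [isTranslationInvariantGibbs_iff_of_corresponds one_le_two hl hμ₁]
      · refine ⟨⟨_, isPeriodic_alternating _ _, hμ₂⟩, ?_⟩
        rw [isTranslationInvariantGibbs_iff_of_corresponds one_le_two hl hμ₂]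
        exact hne.symm
  · refine mem_extremePoints_of_dominates (hμ₁.mem_gibbsMeasures hl) fun ν hν S =>
      gibbs_real_agreeEvent_le_corresponds (e := 0) hl.le hp₁.le hlim (fun x hx => ?_) hμ₁ hν S
    exact alternating_of_even hx
  -- The second measure carries z₁ on the odd vertices, so the odd chessboard (e = 1) is used with
  -- the same limit.
  · refine mem_extremePoints_of_dominates (hμ₂.mem_gibbsMeasures hl) fun ν hν S =>
      gibbs_real_agreeEvent_le_corresponds (e := 1) hl.le hp₁.le hlim (fun x hx => ?_) hμ₂ hν S
    rw [Nat.even_add_one] at hx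
    exact alternating_of_odd hx
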